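/- For a permutation $\pi=\pi_1\cdots\pi_n$ of $\{1,\dots,n\}$ let $\mathrm{inv}(\pi)$ be the number of pairs $k<l$ with $\pi_k>\pi_l$, and let $\mathrm{maj}(\pi)$ be the sum of those $k$, $1\le k<n$, with $\pi_k>\pi_{k+1}$. For $1\le i\le n$ let $S_{n,i}$ be the set of the $(n-1)!$ permutations of $\{1,\dots,n\}$ with $\pi_n=i$, and let $\overline{\mathrm{inv}}$ and $\overline{\mathrm{maj}}$ be the averages of $\mathrm{inv}$ and $\mathrm{maj}$ over $S_{n,i}$. With $z^{(k)}:=z(z-1)\cdots(z-k+1)$, define the mixed factorial moments $$FM(r,s)(n,i):=\frac1{(n-1)!}\sum_{\pi\in S_{n,i}}\bigl(\mathrm{inv}(\pi)-\overline{\mathrm{inv}}\bigr)^{(r)}\bigl(\mathrm{maj}(\pi)-\overline{\mathrm{maj}}\bigr)^{(s)} .$$ Then for all integers $r,s\ge0$ there is a polynomial in $(n,i)$ with rational coefficients that equals $FM(r,s)(n,i)$ for all $1\le i\le n$. Moreover, put $c_{r,s}:=\frac{(2r)!}{2^r r!}\cdot\frac{(2s)!}{2^s s!}$ and write $O_{<d}$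 for some polynomial in $(n,i)$ with rational coefficients (depending on $r,s$) all of whose terms have total degree less than $d$ (so it is $0$ if $d=0$). Then, for all $1\le i\le n$: 1. for $r\ge0$, $s\ge0$, $$FM(2r,2s)(n,i)=c_{r,s}\left(\tfrac1{36}\right)^{r+s}n^{3r+3s}+O_{<3r+3s};$$ 2. for $r\ge0$, $s\ge1$, $$FM(2r,2s-1)(n,i)=c_{r,s}\left(\tfrac1{36}\right)^{r+s-1}n^{3r+3s-6}\left[-(s-1)n^3-6rn^2i+18rni^2-12ri^3\right]+O_{<3r+3s-3}$$ (for $r=0$, $s=1$ the bracket vanishes and the first summand is read as $0$); 3. for $r\ge1$, $s\ge0$, $$FM(2r-1,2s)(n,i)=-c_{r,s}\left(\tfrac1{36}\right)^{r+s-1}(r-1)\,n^{3r+3s-3}+O_{<3r+3s-3};$$ 4. for $r\ge1$, $s\ge1$, $$FM(2r-1,2s-1)(n,i)=c_{r,s}\left(\tfrac1{36}\right)^{r+s-1}\tfrac92\,n^{3r+3s-6}(n-2i)^2+O_{<3r+3s-4}.$$ -/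

import Mathlib

/-- The number of inversions of `π`: pairs of positions `k < l` with `π l < π k`. -/
def permInv {n : ℕ} (π : Equiv.Perm (Fin n)) : ℕ :=
  (Finset.univ.filter (fun p : Fin n × Fin n => p.1 < p.2 ∧ π p.2 < π p.1)).card

/-- The major index of `π`: the sum of the places at which `π` has a descent. Places are counted
from `1`, so the place of the index `k : Fin n` is `k + 1`. -/
def permMaj {n : ℕ} (π : Equiv.Perm (Fin n)) : ℕ :=
  ∑ p ∈ Finset.univ.filter
      (fun p : Fin n × Fin n => (p.2 : ℕ) = (p.1 : ℕ) + 1 ∧ π p.2 < π p.1),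
    ((p.1 : ℕ) + 1)

/-- The permutations of length `n` whose last letter is `i`, for `1 ≤ i ≤ n`. The letters are
`1, …, n`, so the element `π k : Fin n` stands for the letter `π k + 1`. -/
def permsEndingIn (n i : ℕ) : Finset (Equiv.Perm (Fin n)) :=
  Finset.univ.filter (fun π => ∀ k : Fin n, (k : ℕ) + 1 = n → ((π k : ℕ) + 1 = i))

/-- The average of a statistic over a finite set, every element being equally likely. -/
def average {α : Type*} (S : Finset α) (f : α → ℚ) : ℚ :=
  (∑ x ∈ S, f x) / (S.card : ℚ)

/-- The falling factorial `z (z - 1) ⋯ (z - r + 1)`. -/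
def fallingFactorial (z : ℚ) (r : ℕ) : ℚ :=
  ∏ k ∈ Finset.range r, (z - (k : ℚ))

/-- The mixed factorial moment (about the mean) of two statistics over a finite set. -/
def mixedFactorialMoment {α : Type*} (S : Finset α) (f g : α → ℚ) (r s : ℕ) : ℚ :=
  average S (fun x =>
    fallingFactorial (f x - average S f) r * fallingFactorial (g x - average S g) s)

/-- `FM r s n i`: the `(r, s)` mixed factorial moment of the number of inversions and the major
index over the permutations of length `n` that end in `i`. -/
def FM (r s n i : ℕ) : ℚ :=
  mixedFactorialMoment (permsEndingIn n i)
    (fun π => (permInv π : ℚ)) (fun π => (permMaj π : ℚ)) r s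

/-- A polynomial in `(n, i)` (variable `0` is `n`, variable `1` is `i`) agrees with `f` at all the
pairs `1 ≤ i ≤ n`. -/
def RepresentedBy (f : ℕ → ℕ → ℚ) (P : MvPolynomial (Fin 2) ℚ) : Prop :=
  ∀ n i : ℕ, 1 ≤ i → i ≤ n → f n i = MvPolynomial.eval ![(n : ℚ), (i : ℚ)] P

/-- `f` is a polynomial in `(n, i)` on the pairs `1 ≤ i ≤ n`, namely `L` plus terms of total degree
less than `d`. (For `d = 0` there are no such terms.) -/
def EqUpToLowerTotalDegree (f : ℕ → ℕ → ℚ) (L : MvPolynomial (Fin 2) ℚ) (d : ℕ) : Prop :=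
  ∃ Q : MvPolynomial (Fin 2) ℚ,
    (∀ m ∈ Q.support, m.degree < d) ∧ RepresentedBy f (L + Q)

/-- The constant `(2r)! / (2 ^ r r!) · (2s)! / (2 ^ s s!)`. -/
def momentConst (r s : ℕ) : ℚ :=
  (((2 * r).factorial : ℚ) / (2 ^ r * (r.factorial : ℚ))) *
    (((2 * s).factorial : ℚ) / (2 ^ s * (s.factorial : ℚ)))

/-! Delete the last letter. In a uniformly random permutation of length `n` ending in `i`, the last
but one letter `j`, after standardization, is uniform on `1, …, n - 1`, and the centered `inv` and
`maj` grow by u = `invStep n j` and v = `majStep n i j`. The binomial theorem turns this into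
`centralMoment_recurrence`. Averaging against powers of u and v keeps polynomials polynomial and
adds at most p + q to the degree (`PolyOn.step`), although v has a jump and the average divides by
`n - 1`.

The term p = q = 0 of the recurrence is the same moment at `n - 1`, averaged over its last letter.
So the mean over `i` is settled first: it is zero for odd total order, by the reflection `i ↦ n + 1
- i`, and otherwise solves a difference equation in `n`, whose summation adds one degree. The
recurrence then yields the dependence on `i`.

The leading terms come from few moments of the steps. Both steps have variance about n²/12, which
sums to n³/36; this gives Gaussian coefficients for even orders. The mean of uv over `j` is about
n²/12 - i(n - i)/2, but its mean over `i` is only linear, since for fixed `j` the values of v over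
`i` are those of u over all letters, plus u itself (`sum_majStep_left`). With the contribution n²/24
of the mean, this produces (n - 2i)²/8. Finally the mean of u²v is the negative of that of uv², of
leading part -i(n - i)(n - 2i)/6. For orders (odd, even) it cancels against the average of v times
the odd-odd shape; for (even, odd) the average of u times that shape is of lower order, and a cubic
survives. This is the asymmetry between `inv` and `maj`.

All parities are proved together by induction on the total order (`MomentAsymptotics`). Passing to
falling factorials only adds, when exactly one order is odd, the moment with that order lowered by
one. Degrees are doubled throughout, since 3(a + b)/2 may be a half-integer. -/

open Finset

/-! ### Deletion of the last letter -/

/-- The permutation of length `n + 1` that ends in `i` and whose other letters are in the relative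
order given by `σ`. -/
def appendLetter {n : ℕ} (i : Fin (n + 1)) (σ : Equiv.Perm (Fin n)) : Equiv.Perm (Fin (n + 1)) :=
  (finSuccEquiv' (Fin.last n)).trans (σ.optionCongr.trans (finSuccEquiv' i).symm)

theorem appendLetter_last {n : ℕ} (i : Fin (n + 1)) (σ : Equiv.Perm (Fin n)) :
    appendLetter i σ (Fin.last n) = i := by
  simp [appendLetter]

theorem appendLetter_castSucc {n : ℕ} (i : Fin (n + 1)) (σ : Equiv.Perm (Fin n)) (k : Fin n) :
    appendLetter i σ k.castSucc = i.succAbove (σ k) := by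
  simp [appendLetter, finSuccEquiv'_last_apply_castSucc]

theorem appendLetter_injective {n : ℕ} (i : Fin (n + 1)) :
    Function.Injective (appendLetter i) := by
  intro σ τ h
  ext k
  have := congrArg (fun π => π k.castSucc) h
  simp only [appendLetter_castSucc] at this
  rw [Fin.succAbove_right_injective this]

theorem exists_eq_appendLetter {n : ℕ} (π : Equiv.Perm (Fin (n + 1))) :
    ∃ σ, appendLetter (π (Fin.last n)) σ = π := by
  set i := π (Fin.last n) with hi
  -- With the last position and the value `i` both renamed `none`, `π` fixes `none`; its restriction
  -- is the required `σ`.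
  let e : Option (Fin n) ≃ Option (Fin n) :=
    (finSuccEquiv' (Fin.last n)).symm.trans (π.trans (finSuccEquiv' i))
  have hn : e none = none := by simp [e, ← hi]
  refine ⟨e.removeNone, ?_⟩
  ext k
  refine Fin.lastCases ?_ (fun k => ?_) k
  · rw [appendLetter_last]
  · rw [appendLetter_castSucc]
    have hs : ∃ x, e (some k) = some x := by
      rcases h : e (some k) with _ | x
      · exact absurd (e.injective (h.trans hn.symm)) (by simp)
      · exact ⟨x, rfl⟩
    have h1 := Equiv.removeNone_some e hs
    have h2 := congrArg (finSuccEquiv' i).symm h1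
    simp only [finSuccEquiv'_symm_some, e] at h2
    simp only [e]
    rw [h2]
    simp

theorem mem_permsEndingIn_succ {n i : ℕ} {π : Equiv.Perm (Fin (n + 1))} :
    π ∈ permsEndingIn (n + 1) i ↔ (π (Fin.last n) : ℕ) + 1 = i := by
  simp only [permsEndingIn, mem_filter, mem_univ, true_and]
  constructor
  · intro h
    exact h _ (by simp)
  · intro h k hk
    have : k = Fin.last n := by ext; simp; omega
    rw [this, h]

theorem sum_permsEndingIn_succ {n : ℕ} (i : Fin (n + 1)) (F : Equiv.Perm (Fin (n + 1)) → ℚ) :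
    ∑ π ∈ permsEndingIn (n + 1) (i + 1), F π = ∑ σ, F (appendLetter i σ) := by
  symm
  refine Finset.sum_nbij (appendLetter i) ?_ ?_ ?_ ?_
  · intro σ _
    rw [mem_permsEndingIn_succ, appendLetter_last]
  · exact (appendLetter_injective i).injOn
  · intro π hπ
    have h := mem_permsEndingIn_succ.1 (Finset.mem_coe.1 hπ)
    obtain ⟨σ, hσ⟩ := exists_eq_appendLetter π
    have : π (Fin.last n) = i := by ext; omega
    exact ⟨σ, by simp, by rw [← this, hσ]⟩
  · intro σ _; rfl

theorem card_permsEndingIn {n i : ℕ} (hi : 1 ≤ i) (hn : i ≤ n) :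
    (permsEndingIn n i).card = (n - 1).factorial := by
  obtain ⟨n, rfl⟩ : ∃ m, n = m + 1 := ⟨n - 1, by omega⟩
  have h := sum_permsEndingIn_succ (n := n) ⟨i - 1, by omega⟩ (fun _ => 1)
  have hi' : i - 1 + 1 = i := by omega
  simp only [hi', sum_const, card_univ, Fintype.card_perm, Fintype.card_fin, nsmul_eq_mul,
    mul_one] at h
  exact_mod_cast h

theorem sum_perm_eq_sum_permsEndingIn {n : ℕ} (hn : 1 ≤ n) (F : Equiv.Perm (Fin n) → ℚ) :
    ∑ σ, F σ = ∑ j ∈ Ico 1 (n + 1), ∑ σ ∈ permsEndingIn n j, F σ := by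
  obtain ⟨n, rfl⟩ : ∃ m, n = m + 1 := ⟨n - 1, by omega⟩
  rw [← Finset.sum_fiberwise_of_maps_to (t := Ico 1 (n + 1 + 1))
    (g := fun σ : Equiv.Perm (Fin (n + 1)) => (σ (Fin.last n) : ℕ) + 1)]
  · refine Finset.sum_congr rfl fun j _ => Finset.sum_congr ?_ fun _ _ => rfl
    ext σ
    rw [mem_permsEndingIn_succ]
    simp
  · intro σ _
    simp only [mem_Ico]
    omega

/-! ### The two statistics under appending a letter -/

theorem permInv_eq_sum {n : ℕ} (π : Equiv.Perm (Fin n)) :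
    permInv π = ∑ k : Fin n, ∑ l : Fin n, if k < l ∧ π l < π k then 1 else 0 := by
  rw [permInv, Finset.card_filter, Fintype.sum_prod_type]

theorem permMaj_eq_sum {n : ℕ} (π : Equiv.Perm (Fin n)) :
    permMaj π = ∑ k : Fin n, ∑ l : Fin n,
      if (l : ℕ) = (k : ℕ) + 1 ∧ π l < π k then (k : ℕ) + 1 else 0 := by
  rw [permMaj, Finset.sum_filter, Fintype.sum_prod_type]

theorem lt_succAbove_iff_le {n : ℕ} (i : Fin (n + 1)) (v : Fin n) :
    i < i.succAbove v ↔ (i : ℕ) ≤ v := by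
  rw [Fin.lt_succAbove_iff_le_castSucc, Fin.le_def]
  simp

/-- Old inversions depend only on relative order, and the last letter forms one new inversion with
each larger letter; `i` counts from 0, so there are `n - i` of these. -/
theorem permInv_appendLetter {n : ℕ} (i : Fin (n + 1)) (σ : Equiv.Perm (Fin n)) :
    permInv (appendLetter i σ) = permInv σ + (n - i) := by
  rw [permInv_eq_sum, permInv_eq_sum, Fin.sum_univ_castSucc]
  simp only [Fin.sum_univ_castSucc (n := n), appendLetter_last, appendLetter_castSucc,
    Fin.castSucc_lt_castSucc_iff, Fin.succAbove_lt_succAbove_iff, Fin.castSucc_lt_last, true_and,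
    lt_irrefl, false_and, if_false, add_zero]
  have h1 : ∀ k : Fin n, ¬ Fin.last n < k.castSucc := fun k => not_lt.2 (Fin.le_last _)
  simp only [h1, false_and, if_false, sum_const_zero, add_zero, sum_add_distrib]
  congr 1
  rw [Equiv.sum_comp σ (fun v => if i < i.succAbove v then 1 else 0)]
  simp only [lt_succAbove_iff_le]
  rw [Fin.sum_univ_eq_sum_range (fun v => if (i : ℕ) ≤ v then 1 else 0) n,
    ← Finset.card_filter]
  have : (Finset.range n).filter (fun v => (i : ℕ) ≤ v) = Finset.Ico (i : ℕ) n := by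
    ext v; simp; tauto
  rw [this, Nat.card_Ico]

/-- The only new adjacent pair sits at place `n + 1`. Letters from `i` on are shifted up by one, so
equality with `i` before the shift already makes a descent. -/
theorem permMaj_appendLetter {n : ℕ} (i : Fin (n + 2)) (σ : Equiv.Perm (Fin (n + 1))) :
    permMaj (appendLetter i σ) =
      permMaj σ + if (i : ℕ) ≤ σ (Fin.last n) then n + 1 else 0 := by
  rw [permMaj_eq_sum, permMaj_eq_sum, Fin.sum_univ_castSucc]
  simp only [Fin.sum_univ_castSucc (n := n + 1), appendLetter_last, appendLetter_castSucc,
    Fin.succAbove_lt_succAbove_iff, lt_irrefl, and_false, if_false, add_zero, Fin.val_castSucc,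
    Fin.val_last, lt_succAbove_iff_le]
  have h1 : ∀ k : Fin (n + 1), ¬ ((k : ℕ) = n + 1 + 1) := fun k => by omega
  simp only [h1, false_and, if_false, sum_const_zero, add_zero, sum_add_distrib]
  congr 1
  rw [Fin.sum_univ_castSucc]
  simp only [Fin.val_castSucc, Fin.val_last, true_and, Nat.add_eq_right]
  refine Finset.sum_eq_zero fun k _ => if_neg fun h => ?_
  omega

/-! ### Central moments: recurrence and reflection -/

/-- The common mean of `inv` and `maj` over the permutations of length `n` ending in `i`. -/
def invMajMean (n i : ℕ) : ℚ := ((n : ℚ) - 1) * ((n : ℚ) - 2) / 4 + n - i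

/-- The mixed central moments of `inv` and `maj` over the permutations of length `n` ending
in `i`. -/
def centralMoment (a b n i : ℕ) : ℚ :=
  (∑ π ∈ permsEndingIn n i,
    ((permInv π : ℚ) - invMajMean n i) ^ a * ((permMaj π : ℚ) - invMajMean n i) ^ b) /
    ((n - 1).factorial : ℚ)

/-- The change of the centered number of inversions when a last letter is appended to a permutation
of length `n - 1` that ends in `j`. -/
def invStep (n j : ℕ) : ℚ := n / 2 - j

/-- The change of the centered major index when the last letter `i` is appended to a permutation
of length `n - 1` that ends in `j`. -/
def majStep (n i j : ℕ) : ℚ := i - j - n / 2 + if i ≤ j then (n : ℚ) - 1 else 0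

/-- The average over the last but one letter `j` of `f (n - 1) j`, weighted by powers of the two
steps. -/
def stepAverage (p q : ℕ) (f : ℕ → ℕ → ℚ) (n i : ℕ) : ℚ :=
  (∑ j ∈ Ico 1 n, invStep n j ^ p * majStep n i j ^ q * f (n - 1) j) / ((n : ℚ) - 1)

/-- The growth of `inv` depends on `i` alone and is absorbed by the centering. The letter `j` enters
only through the old mean, hence needs no relation to `σ` here. -/
theorem centered_permInv_appendLetter {n : ℕ} (i : Fin (n + 2)) (σ : Equiv.Perm (Fin (n + 1)))
    (j : ℕ) :
    (permInv (appendLetter i σ) : ℚ) - invMajMean (n + 2) (i + 1) =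
      ((permInv σ : ℚ) - invMajMean (n + 1) j) + invStep (n + 2) j := by
  have hi : (i : ℕ) ≤ n + 1 := by omega
  rw [permInv_appendLetter]
  simp only [invMajMean, invStep]
  push_cast [Nat.cast_sub hi]
  ring

theorem centered_permMaj_appendLetter {n : ℕ} (i : Fin (n + 2)) (σ : Equiv.Perm (Fin (n + 1)))
    {j : ℕ} (hj : (σ (Fin.last n) : ℕ) + 1 = j) :
    (permMaj (appendLetter i σ) : ℚ) - invMajMean (n + 2) (i + 1) =
      ((permMaj σ : ℚ) - invMajMean (n + 1) j) + majStep (n + 2) (i + 1) j := by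
  rw [permMaj_appendLetter, ← hj]
  simp only [invMajMean, majStep, Nat.add_le_add_iff_right]
  split_ifs <;> push_cast <;> ring

theorem centralMoment_recurrence (a b : ℕ) {n i : ℕ} (hn : 2 ≤ n) (hi : 1 ≤ i) (hin : i ≤ n) :
    centralMoment a b n i = ∑ p ∈ range (a + 1), ∑ q ∈ range (b + 1),
      (a.choose p : ℚ) * (b.choose q : ℚ) *
        stepAverage p q (centralMoment (a - p) (b - q)) n i := by
  obtain ⟨n, rfl⟩ : ∃ m, n = m + 2 := ⟨n - 2, by omega⟩
  obtain ⟨i, rfl⟩ : ∃ k : Fin (n + 2), i = k + 1 := ⟨⟨i - 1, by omega⟩, by simp; omega⟩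
  have key : ∀ j ∈ Ico 1 (n + 2), ∀ σ ∈ permsEndingIn (n + 1) j,
      ((permInv (appendLetter i σ) : ℚ) - invMajMean (n + 2) (i + 1)) ^ a *
        ((permMaj (appendLetter i σ) : ℚ) - invMajMean (n + 2) (i + 1)) ^ b =
      ∑ p ∈ range (a + 1), ∑ q ∈ range (b + 1), (a.choose p : ℚ) * (b.choose q : ℚ) *
        (invStep (n + 2) j ^ p * majStep (n + 2) (i + 1) j ^ q *
          (((permInv σ : ℚ) - invMajMean (n + 1) j) ^ (a - p) *
            ((permMaj σ : ℚ) - invMajMean (n + 1) j) ^ (b - q))) := by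
    intro j _ σ hσ
    rw [centered_permInv_appendLetter i σ j,
      centered_permMaj_appendLetter i σ (mem_permsEndingIn_succ.1 hσ),
      add_comm _ (invStep _ _), add_comm _ (majStep _ _ _), add_pow, add_pow, Finset.sum_mul_sum]
    refine sum_congr rfl fun p _ => sum_congr rfl fun q _ => ?_
    ring
  rw [centralMoment, sum_permsEndingIn_succ, sum_perm_eq_sum_permsEndingIn (by omega),
    Finset.sum_congr rfl fun j hj => Finset.sum_congr rfl (key j hj)]
  have hfac : (((n + 2 - 1 : ℕ).factorial : ℕ) : ℚ) = ((n : ℚ) + 1) * (n.factorial : ℚ) := by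
    rw [show n + 2 - 1 = n + 1 by omega, Nat.factorial_succ]; push_cast; ring
  have hn1 : (n : ℚ) + 1 ≠ 0 := by positivity
  have hn2 : (n.factorial : ℚ) ≠ 0 := by positivity
  rw [hfac, div_eq_iff (by positivity), Finset.sum_mul]
  simp only [Finset.sum_mul]
  have swap : ∀ F : ℕ → ℕ → ∀ j : ℕ, Equiv.Perm (Fin (n + 1)) → ℚ,
      ∑ j ∈ Ico 1 (n + 1 + 1), ∑ σ ∈ permsEndingIn (n + 1) j,
        ∑ p ∈ range (a + 1), ∑ q ∈ range (b + 1), F p q j σ =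
      ∑ p ∈ range (a + 1), ∑ q ∈ range (b + 1),
        ∑ j ∈ Ico 1 (n + 1 + 1), ∑ σ ∈ permsEndingIn (n + 1) j, F p q j σ := by
    intro F
    rw [sum_congr rfl fun j _ => sum_comm, sum_comm]
    refine sum_congr rfl fun p _ => ?_
    rw [sum_congr rfl fun j _ => sum_comm, sum_comm]
  rw [swap]
  refine sum_congr rfl fun p _ => sum_congr rfl fun q _ => ?_
  simp only [← Finset.mul_sum]
  rw [mul_assoc ((a.choose p : ℚ) * (b.choose q : ℚ))]
  congr 1
  rw [stepAverage, show n + 2 - 1 = n + 1 by omega]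
  simp only [centralMoment, show n + 1 - 1 = n by omega]
  push_cast
  rw [show (n : ℚ) + 2 - 1 = n + 1 by ring, div_mul_eq_mul_div, eq_div_iff hn1, Finset.sum_mul,
    Finset.sum_mul]
  refine sum_congr rfl fun j _ => ?_
  field_simp

theorem permsEndingIn_one : permsEndingIn 1 1 = Finset.univ := by decide

theorem centralMoment_one (a b : ℕ) :
    centralMoment a b 1 1 = if a = 0 ∧ b = 0 then 1 else 0 := by
  have h1 : ∀ π : Equiv.Perm (Fin 1), permInv π = 0 := by decide
  have h2 : ∀ π : Equiv.Perm (Fin 1), permMaj π = 0 := by decide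
  simp only [centralMoment, permsEndingIn_one, h1, h2, invMajMean]
  rcases a with _ | a <;> rcases b with _ | b <;> simp

theorem centralMoment_zero_zero {n i : ℕ} (hi : 1 ≤ i) (hn : i ≤ n) :
    centralMoment 0 0 n i = 1 := by
  have : ((n - 1).factorial : ℚ) ≠ 0 := by positivity
  simp [centralMoment, card_permsEndingIn hi hn, this]

theorem invStep_reflect {n j : ℕ} (hj : j ≤ n) : invStep n (n - j) = -invStep n j := by
  simp only [invStep, Nat.cast_sub hj]; ring

/-- The reflection exchanges the cases `i ≤ j` and `j < i`. -/
theorem majStep_reflect {n i j : ℕ} (hj : j ≤ n) (hi : i ≤ n) :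
    majStep n (n + 1 - i) (n - j) = -majStep n i j := by
  simp only [majStep]
  rw [Nat.cast_sub hj, Nat.cast_sub (by omega)]
  push_cast
  by_cases h : i ≤ j
  · rw [if_pos h, if_neg (by omega)]; ring
  · rw [if_neg h, if_pos (by omega)]; ring

/-- Both steps change sign under the reflection of `i` and `j`, so the sign propagates through the
recurrence. -/
theorem centralMoment_reflect (n : ℕ) : ∀ a b i : ℕ, 1 ≤ i → i ≤ n →
    centralMoment a b n (n + 1 - i) = (-1) ^ (a + b) * centralMoment a b n i := by
  induction n with
  | zero => intro a b i h1 h2; omega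
  | succ n ih =>
    intro a b i h1 h2
    rcases Nat.eq_zero_or_pos n with rfl | hn
    · obtain rfl : i = 1 := by omega
      change centralMoment a b 1 1 = _ * centralMoment a b 1 1
      simp only [centralMoment_one]
      split_ifs with h
      · simp [h.1, h.2]
      · simp
    rw [centralMoment_recurrence a b (by omega) (by omega) (by omega),
      centralMoment_recurrence a b (by omega) h1 h2, Finset.mul_sum]
    refine sum_congr rfl fun p hp => ?_
    rw [Finset.mul_sum]
    refine sum_congr rfl fun q hq => ?_
    rw [mem_range] at hp hq
    rw [mul_left_comm]
    congr 1
    rw [stepAverage, stepAverage, mul_div_assoc', Finset.mul_sum]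
    congr 1
    have hr := Finset.sum_Ico_reflect (fun j => invStep (n + 1) j ^ p *
      majStep (n + 1) (n + 1 + 1 - i) j ^ q * centralMoment (a - p) (b - q) (n + 1 - 1) j)
      1 (Nat.le_succ (n + 1))
    rw [show n + 1 + 1 - (n + 1) = 1 by omega, show n + 1 + 1 - 1 = n + 1 by omega] at hr
    rw [← hr]
    refine sum_congr rfl fun j hj => ?_
    rw [mem_Ico] at hj
    rw [invStep_reflect (by omega), majStep_reflect (by omega) h2]
    have := ih (a - p) (b - q) j hj.1 (by omega)
    rw [show n + 1 - 1 = n by omega, this, neg_pow (invStep _ _), neg_pow (majStep _ _ _)]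
    rw [show a + b = p + q + (a - p + (b - q)) by omega, pow_add, pow_add]
    ring

/-! ### Polynomial functions graded by twice the degree -/

/-- The polynomial functions of `(n, i)` all of whose terms have a total degree `d` with
`2 * d ≤ e`. -/
def polyFun (e : ℤ) : Submodule ℚ (ℕ → ℕ → ℚ) :=
  Submodule.span ℚ {f | ∃ α β : ℕ, 2 * ((α : ℤ) + β) ≤ e ∧
    f = fun (n i : ℕ) => (n : ℚ) ^ α * (i : ℚ) ^ β}

/-- The polynomial functions of `(n, i, j)` all of whose terms have a total degree `d` with
`2 * d ≤ e`. -/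
def polyFun₃ (e : ℤ) : Submodule ℚ (ℕ → ℕ → ℕ → ℚ) :=
  Submodule.span ℚ {f | ∃ α β γ : ℕ, 2 * ((α : ℤ) + β + γ) ≤ e ∧
    f = fun (n i j : ℕ) => (n : ℚ) ^ α * (i : ℚ) ^ β * (j : ℚ) ^ γ}

namespace polyFun

theorem mono {e e' : ℤ} (h : e ≤ e') : polyFun e ≤ polyFun e' := by
  apply Submodule.span_mono
  rintro f ⟨α, β, h1, rfl⟩
  exact ⟨α, β, by omega, rfl⟩

theorem monomial {e : ℤ} (α β : ℕ) (h : 2 * ((α : ℤ) + β) ≤ e) :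
    (fun (n i : ℕ) => (n : ℚ) ^ α * (i : ℚ) ^ β) ∈ polyFun e :=
  Submodule.subset_span ⟨α, β, h, rfl⟩

theorem mul {e e' : ℤ} {f g : ℕ → ℕ → ℚ} (hf : f ∈ polyFun e) (hg : g ∈ polyFun e') :
    f * g ∈ polyFun (e + e') := by
  have h : f * g ∈ polyFun e * polyFun e' := Submodule.mul_mem_mul hf hg
  rw [polyFun, polyFun, Submodule.span_mul_span] at h
  refine Submodule.span_mono ?_ h
  rintro _ ⟨_, ⟨α, β, h1, rfl⟩, _, ⟨α', β', h2, rfl⟩, rfl⟩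
  refine ⟨α + α', β + β', by push_cast; omega, ?_⟩
  funext n i
  simp only [Pi.mul_apply, pow_add]
  ring

theorem const {e : ℤ} (c : ℚ) (h : 0 ≤ e) : (fun _ _ => c) ∈ polyFun e := by
  have := (polyFun e).smul_mem c (monomial 0 0 (by simpa using h))
  simpa [Pi.smul_def] using this

theorem pow {e : ℤ} {f : ℕ → ℕ → ℚ} (hf : f ∈ polyFun e) (k : ℕ) : f ^ k ∈ polyFun (k * e) := by
  induction k with
  | zero => rw [pow_zero]; exact const 1 (by push_cast; linarith)
  | succ k ih =>
    rw [pow_succ]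
    exact mono (by push_cast; linarith) (mul ih hf)

end polyFun

namespace polyFun₃

theorem mono {e e' : ℤ} (h : e ≤ e') : polyFun₃ e ≤ polyFun₃ e' := by
  apply Submodule.span_mono
  rintro f ⟨α, β, γ, h1, rfl⟩
  exact ⟨α, β, γ, by omega, rfl⟩

theorem monomial {e : ℤ} (α β γ : ℕ) (h : 2 * ((α : ℤ) + β + γ) ≤ e) :
    (fun (n i j : ℕ) => (n : ℚ) ^ α * (i : ℚ) ^ β * (j : ℚ) ^ γ) ∈ polyFun₃ e :=
  Submodule.subset_span ⟨α, β, γ, h, rfl⟩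

theorem mul {e e' : ℤ} {f g : ℕ → ℕ → ℕ → ℚ} (hf : f ∈ polyFun₃ e) (hg : g ∈ polyFun₃ e') :
    f * g ∈ polyFun₃ (e + e') := by
  have h : f * g ∈ polyFun₃ e * polyFun₃ e' := Submodule.mul_mem_mul hf hg
  rw [polyFun₃, polyFun₃, Submodule.span_mul_span] at h
  refine Submodule.span_mono ?_ h
  rintro _ ⟨_, ⟨α, β, γ, h1, rfl⟩, _, ⟨α', β', γ', h2, rfl⟩, rfl⟩
  refine ⟨α + α', β + β', γ + γ', by push_cast; omega, ?_⟩
  funext n i j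
  simp only [Pi.mul_apply, pow_add]
  ring

theorem const {e : ℤ} (c : ℚ) (h : 0 ≤ e) : (fun _ _ _ => c) ∈ polyFun₃ e := by
  have := (polyFun₃ e).smul_mem c (monomial 0 0 0 (by simpa using h))
  simpa [Pi.smul_def] using this

theorem pow {e : ℤ} {f : ℕ → ℕ → ℕ → ℚ} (hf : f ∈ polyFun₃ e) (k : ℕ) :
    f ^ k ∈ polyFun₃ (k * e) := by
  induction k with
  | zero => rw [pow_zero]; exact const 1 (by push_cast; linarith)
  | succ k ih =>
    rw [pow_succ]
    exact mono (by push_cast; linarith) (mul ih hf)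

theorem var_n : (fun (n _ _ : ℕ) => (n : ℚ)) ∈ polyFun₃ 2 := by
  simpa using monomial (e := 2) 1 0 0 (by norm_num)

theorem var_i : (fun (_ i _ : ℕ) => (i : ℚ)) ∈ polyFun₃ 2 := by
  simpa using monomial (e := 2) 0 1 0 (by norm_num)

theorem var_j : (fun (_ _ j : ℕ) => (j : ℚ)) ∈ polyFun₃ 2 := by
  simpa using monomial (e := 2) 0 0 1 (by norm_num)

/-- Substituting `(n - 1, j)` in a polynomial function of two variables. -/
theorem of_polyFun {e : ℤ} {g : ℕ → ℕ → ℚ} (hg : g ∈ polyFun e) :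
    ∃ G ∈ polyFun₃ e, ∀ n i j : ℕ, 1 ≤ n → g (n - 1) j = G n i j := by
  induction hg using Submodule.span_induction with
  | mem f hf =>
    obtain ⟨α, β, h, rfl⟩ := hf
    refine ⟨(fun (n _ _ : ℕ) => (n : ℚ) - 1) ^ α * (fun (_ _ j : ℕ) => (j : ℚ)) ^ β, ?_, ?_⟩
    · have h1 : (fun (n _ _ : ℕ) => (n : ℚ) - 1) ∈ polyFun₃ 2 :=
        (polyFun₃ 2).sub_mem var_n (const 1 (by norm_num))
      exact mono (by linarith) (mul (pow h1 α) (pow var_j β))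
    · intro n i j hn
      simp [Nat.cast_sub hn]
  | zero => exact ⟨0, Submodule.zero_mem _, by simp⟩
  | add f g _ _ hf hg =>
    obtain ⟨F, hF, hF'⟩ := hf
    obtain ⟨G, hG, hG'⟩ := hg
    refine ⟨F + G, Submodule.add_mem _ hF hG, fun n i j hn => ?_⟩
    simp [hF' n i j hn, hG' n i j hn]
  | smul c f _ hf =>
    obtain ⟨F, hF, hF'⟩ := hf
    refine ⟨c • F, Submodule.smul_mem _ c hF, fun n i j hn => ?_⟩
    simp [hF' n i j hn]

end polyFun₃

/-! ### Summation of polynomial functions -/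

/-- The average of the `γ`-th powers of `1, …, m` is a polynomial of degree `γ` in `m`. -/
theorem exists_average_pow (γ : ℕ) : ∃ c : ℕ → ℚ, ∀ m : ℕ, 1 ≤ m →
    (∑ k ∈ Ico 1 (m + 1), (k : ℚ) ^ γ) / m = ∑ l ∈ range (γ + 1), c l * (m : ℚ) ^ (γ - l) := by
  refine ⟨fun l => bernoulli' l * (γ + 1).choose l / (γ + 1), fun m hm => ?_⟩
  have hm' : (m : ℚ) ≠ 0 := by positivity
  rw [sum_Ico_pow, Finset.sum_div]
  refine sum_congr rfl fun l hl => ?_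
  rw [mem_range] at hl
  rw [show γ + 1 - l = γ - l + 1 by omega, pow_succ]
  field_simp

/-- The power sums up to `n - 1` are divisible by `n - 1` as polynomials, so a full average costs
neither polynomiality nor degree. -/
theorem polyFun_average {e : ℤ} {G : ℕ → ℕ → ℕ → ℚ} (hG : G ∈ polyFun₃ e) :
    ∃ g ∈ polyFun e, ∀ n i : ℕ, 2 ≤ n → (∑ j ∈ Ico 1 n, G n i j) / ((n : ℚ) - 1) = g n i := by
  induction hG using Submodule.span_induction with
  | mem f hf =>
    obtain ⟨α, β, γ, h, rfl⟩ := hf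
    obtain ⟨c, hc⟩ := exists_average_pow γ
    refine ⟨(fun (n i : ℕ) => (n : ℚ) ^ α * (i : ℚ) ^ β) *
      ∑ l ∈ range (γ + 1), c l • (fun (n _ : ℕ) => (n : ℚ) - 1) ^ (γ - l), ?_, ?_⟩
    · have h1 : (fun (n _ : ℕ) => (n : ℚ) - 1) ∈ polyFun 2 := by
        refine (polyFun 2).sub_mem ?_ (polyFun.const 1 (by norm_num))
        simpa using polyFun.monomial (e := 2) 1 0 (by norm_num)
      have h2 : ∑ l ∈ range (γ + 1), c l • (fun (n : ℕ) (_ : ℕ) => (n : ℚ) - 1) ^ (γ - l) ∈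
          polyFun (2 * γ) := by
        refine Submodule.sum_mem _ fun l _ => Submodule.smul_mem _ _ ?_
        refine polyFun.mono ?_ (polyFun.pow h1 (γ - l))
        have : ((γ - l : ℕ) : ℤ) ≤ γ := by omega
        linarith
      exact polyFun.mono (by linarith) (polyFun.mul (polyFun.monomial α β (le_refl _)) h2)
    · intro n i hn
      have := hc (n - 1) (by omega)
      rw [show n - 1 + 1 = n by omega, Nat.cast_sub (by omega)] at this
      push_cast at this
      simp only [Pi.mul_apply, Finset.sum_apply, Pi.smul_apply, Pi.pow_apply, smul_eq_mul]
      rw [← Finset.mul_sum, mul_div_assoc, this]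
  | zero => exact ⟨0, Submodule.zero_mem _, by simp⟩
  | add f g _ _ hf hg =>
    obtain ⟨F, hF, hF'⟩ := hf
    obtain ⟨G, hG, hG'⟩ := hg
    refine ⟨F + G, Submodule.add_mem _ hF hG, fun n i hn => ?_⟩
    simp only [Pi.add_apply, ← hF' n i hn, ← hG' n i hn, Finset.sum_add_distrib, add_div]
  | smul c f _ hf =>
    obtain ⟨F, hF, hF'⟩ := hf
    refine ⟨c • F, Submodule.smul_mem _ c hF, fun n i hn => ?_⟩
    simp only [Pi.smul_apply, ← hF' n i hn, smul_eq_mul, ← Finset.mul_sum, mul_div_assoc]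

/-- A difference of two Faulhaber polynomials. Nothing is divided out, so one degree is gained. -/
theorem polyFun_tailSum {e : ℤ} {G : ℕ → ℕ → ℕ → ℚ} (hG : G ∈ polyFun₃ e) :
    ∃ g ∈ polyFun (e + 2), ∀ n i : ℕ, i ≤ n → ∑ j ∈ Ico i n, G n i j = g n i := by
  induction hG using Submodule.span_induction with
  | mem f hf =>
    obtain ⟨α, β, γ, h, rfl⟩ := hf
    refine ⟨(fun (n i : ℕ) => (n : ℚ) ^ α * (i : ℚ) ^ β) *
      ∑ l ∈ range (γ + 1), (bernoulli l * (γ + 1).choose l / (γ + 1)) •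
        ((fun (n i : ℕ) => (n : ℚ) ^ (γ + 1 - l) * (i : ℚ) ^ 0) -
          fun (n i : ℕ) => (n : ℚ) ^ 0 * (i : ℚ) ^ (γ + 1 - l)), ?_, ?_⟩
    · refine polyFun.mono (e := 2 * (α + β) + 2 * (γ + 1)) (by linarith)
        (polyFun.mul (polyFun.monomial α β (le_refl _)) ?_)
      refine Submodule.sum_mem _ fun l _ => Submodule.smul_mem _ _ (Submodule.sub_mem _ ?_ ?_) <;>
      exact polyFun.monomial _ _ (by push_cast; omega)
    · intro n i hn
      simp only [Pi.mul_apply, Finset.sum_apply, Pi.smul_apply, Pi.sub_apply, smul_eq_mul]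
      rw [← Finset.mul_sum, Finset.sum_Ico_eq_sub _ hn, sum_range_pow, sum_range_pow,
        ← Finset.sum_sub_distrib]
      congr 1
      refine sum_congr rfl fun l _ => ?_
      ring
  | zero => exact ⟨0, Submodule.zero_mem _, by simp⟩
  | add f g _ _ hf hg =>
    obtain ⟨F, hF, hF'⟩ := hf
    obtain ⟨G, hG, hG'⟩ := hg
    refine ⟨F + G, Submodule.add_mem _ hF hG, fun n i hn => ?_⟩
    simp only [Pi.add_apply, ← hF' n i hn, ← hG' n i hn, Finset.sum_add_distrib]
  | smul c f _ hf =>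
    obtain ⟨F, hF, hF'⟩ := hf
    refine ⟨c • F, Submodule.smul_mem _ c hF, fun n i hn => ?_⟩
    simp only [Pi.smul_apply, ← hF' n i hn, smul_eq_mul, ← Finset.mul_sum]

theorem polyFun_partialSum {e : ℤ} {g : ℕ → ℕ → ℚ} (hg : g ∈ polyFun e) :
    ∃ h ∈ polyFun (e + 2), ∀ n i : ℕ, 1 ≤ n → ∑ k ∈ Ico 1 (n + 1), g k 1 = h n i := by
  induction hg using Submodule.span_induction with
  | mem f hf =>
    obtain ⟨α, β, h, rfl⟩ := hf
    obtain ⟨c, hc⟩ := exists_average_pow α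
    refine ⟨∑ l ∈ range (α + 1), c l • fun (n i : ℕ) => (n : ℚ) ^ (α - l + 1) * (i : ℚ) ^ 0, ?_, ?_⟩
    · refine Submodule.sum_mem _ fun l _ => Submodule.smul_mem _ _ ?_
      exact polyFun.monomial _ _ (by push_cast; omega)
    · intro n i hn
      have := hc n hn
      rw [div_eq_iff (by positivity)] at this
      simp only [Finset.sum_apply, Pi.smul_apply, smul_eq_mul, Nat.cast_one, one_pow, mul_one,
        pow_zero, this, Finset.sum_mul]
      refine sum_congr rfl fun l _ => ?_
      ring
  | zero => exact ⟨0, Submodule.zero_mem _, by simp⟩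
  | add f g _ _ hf hg =>
    obtain ⟨F, hF, hF'⟩ := hf
    obtain ⟨G, hG, hG'⟩ := hg
    refine ⟨F + G, Submodule.add_mem _ hF hG, fun n i hn => ?_⟩
    simp only [Pi.add_apply, ← hF' n i hn, ← hG' n i hn, Finset.sum_add_distrib]
  | smul c f _ hf =>
    obtain ⟨F, hF, hF'⟩ := hf
    refine ⟨c • F, Submodule.smul_mem _ c hF, fun n i hn => ?_⟩
    simp only [Pi.smul_apply, ← hF' n i hn, smul_eq_mul, ← Finset.mul_sum]

theorem polyFun_letterSum {e : ℤ} {g : ℕ → ℕ → ℚ} (hg : g ∈ polyFun e) :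
    ∃ h ∈ polyFun e, ∀ n i : ℕ, 1 ≤ n → (∑ k ∈ Ico 1 (n + 1), g n k) / (n : ℚ) = h n i := by
  induction hg using Submodule.span_induction with
  | mem f hf =>
    obtain ⟨α, β, h, rfl⟩ := hf
    obtain ⟨c, hc⟩ := exists_average_pow β
    refine ⟨∑ l ∈ range (β + 1), c l • fun (n i : ℕ) => (n : ℚ) ^ (α + (β - l)) * (i : ℚ) ^ 0, ?_, ?_⟩
    · refine Submodule.sum_mem _ fun l _ => Submodule.smul_mem _ _ ?_
      exact polyFun.monomial _ _ (by push_cast; omega)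
    · intro n i hn
      rw [← Finset.mul_sum, mul_div_assoc, hc n hn, Finset.mul_sum]
      simp only [Finset.sum_apply, Pi.smul_apply, smul_eq_mul, pow_zero, mul_one]
      refine sum_congr rfl fun l _ => ?_
      rw [pow_add]; ring
  | zero => exact ⟨0, Submodule.zero_mem _, by simp⟩
  | add f g _ _ hf hg =>
    obtain ⟨F, hF, hF'⟩ := hf
    obtain ⟨G, hG, hG'⟩ := hg
    refine ⟨F + G, Submodule.add_mem _ hF hG, fun n i hn => ?_⟩
    simp only [Pi.add_apply, ← hF' n i hn, ← hG' n i hn, Finset.sum_add_distrib, add_div]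
  | smul c f _ hf =>
    obtain ⟨F, hF, hF'⟩ := hf
    refine ⟨c • F, Submodule.smul_mem _ c hF, fun n i hn => ?_⟩
    simp only [Pi.smul_apply, ← hF' n i hn, smul_eq_mul, ← Finset.mul_sum, mul_div_assoc]

theorem polyFun_exists_polynomial {e : ℤ} {g : ℕ → ℕ → ℚ} (hg : g ∈ polyFun e) :
    ∃ P : Polynomial ℚ, ∀ n : ℕ, g n 1 = P.eval (n : ℚ) := by
  induction hg using Submodule.span_induction with
  | mem f hf =>
    obtain ⟨α, β, h, rfl⟩ := hf
    exact ⟨Polynomial.X ^ α, by simp⟩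
  | zero => exact ⟨0, by simp⟩
  | add f g _ _ hf hg =>
    obtain ⟨F, hF⟩ := hf
    obtain ⟨G, hG⟩ := hg
    exact ⟨F + G, by simp [hF, hG]⟩
  | smul c f _ hf =>
    obtain ⟨F, hF⟩ := hf
    exact ⟨Polynomial.C c * F, by simp [hF]⟩

theorem polyFun_exists_mvPolynomial {e : ℤ} {g : ℕ → ℕ → ℚ} (hg : g ∈ polyFun e) :
    ∃ Q : MvPolynomial (Fin 2) ℚ, (∀ m ∈ Q.support, 2 * (m.degree : ℤ) ≤ e) ∧
      ∀ n i : ℕ, g n i = MvPolynomial.eval ![(n : ℚ), (i : ℚ)] Q := by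
  classical
  induction hg using Submodule.span_induction with
  | mem f hf =>
    obtain ⟨α, β, h, rfl⟩ := hf
    refine ⟨MvPolynomial.monomial (Finsupp.single 0 α + Finsupp.single 1 β) 1, ?_, ?_⟩
    · intro m hm
      have := MvPolynomial.support_monomial_subset hm
      rw [Finset.mem_singleton] at this
      rw [this]
      simpa [map_add] using h
    · intro n i
      rw [MvPolynomial.eval_monomial, Finsupp.prod_add_index' (by simp) (by intros; rw [pow_add])]
      simp
  | zero => exact ⟨0, by simp⟩
  | add f g _ _ hf hg =>
    obtain ⟨F, hF, hF'⟩ := hf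
    obtain ⟨G, hG, hG'⟩ := hg
    refine ⟨F + G, fun m hm => ?_, fun n i => by simp [hF', hG']⟩
    rcases Finset.mem_union.1 (MvPolynomial.support_add hm) with h | h
    exacts [hF m h, hG m h]
  | smul c f _ hf =>
    obtain ⟨F, hF, hF'⟩ := hf
    exact ⟨c • F, fun m hm => hF m (MvPolynomial.support_smul hm), fun n i => by simp [hF']⟩

/-! ### Functions that are polynomial on the triangle `1 ≤ i ≤ n` -/

/-- On the pairs `1 ≤ i ≤ n` with `N ≤ n` the function `f` is a polynomial all of whose terms have a
total degree `d` with `2 * d ≤ e`. -/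
def PolyOn (N : ℕ) (e : ℤ) (f : ℕ → ℕ → ℚ) : Prop :=
  ∃ g ∈ polyFun e, ∀ n i : ℕ, N ≤ n → 1 ≤ i → i ≤ n → f n i = g n i

/-- The average of `f n i` over the letters `i` from `1` to `n`. -/
def letterMean (f : ℕ → ℕ → ℚ) (n : ℕ) : ℚ := (∑ i ∈ Ico 1 (n + 1), f n i) / (n : ℚ)

namespace PolyOn

variable {N : ℕ} {e e' : ℤ} {f g : ℕ → ℕ → ℚ}

theorem mono (hf : PolyOn N e f) (h : e ≤ e') : PolyOn N e' f := by
  obtain ⟨F, hF, hF'⟩ := hf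
  exact ⟨F, polyFun.mono h hF, hF'⟩

theorem mono_left (hf : PolyOn N e f) {N' : ℕ} (h : N ≤ N') : PolyOn N' e f := by
  obtain ⟨F, hF, hF'⟩ := hf
  exact ⟨F, hF, fun n i hn => hF' n i (h.trans hn)⟩

theorem congr (hf : PolyOn N e f) (h : ∀ n i : ℕ, N ≤ n → 1 ≤ i → i ≤ n → g n i = f n i) :
    PolyOn N e g := by
  obtain ⟨F, hF, hF'⟩ := hf
  exact ⟨F, hF, fun n i h1 h2 h3 => (h n i h1 h2 h3).trans (hF' n i h1 h2 h3)⟩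

theorem zero : PolyOn N e (fun _ _ => 0) := ⟨0, Submodule.zero_mem _, by simp⟩

theorem add (hf : PolyOn N e f) (hg : PolyOn N e g) : PolyOn N e (fun n i => f n i + g n i) := by
  obtain ⟨F, hF, hF'⟩ := hf
  obtain ⟨G, hG, hG'⟩ := hg
  exact ⟨F + G, Submodule.add_mem _ hF hG, fun n i h1 h2 h3 => by
    simp [hF' n i h1 h2 h3, hG' n i h1 h2 h3]⟩

theorem sub (hf : PolyOn N e f) (hg : PolyOn N e g) : PolyOn N e (fun n i => f n i - g n i) := by
  obtain ⟨F, hF, hF'⟩ := hf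
  obtain ⟨G, hG, hG'⟩ := hg
  exact ⟨F - G, Submodule.sub_mem _ hF hG, fun n i h1 h2 h3 => by
    simp [hF' n i h1 h2 h3, hG' n i h1 h2 h3]⟩

theorem const_mul (c : ℚ) (hf : PolyOn N e f) : PolyOn N e (fun n i => c * f n i) := by
  obtain ⟨F, hF, hF'⟩ := hf
  exact ⟨c • F, Submodule.smul_mem _ _ hF, fun n i h1 h2 h3 => by simp [hF' n i h1 h2 h3]⟩

theorem neg (hf : PolyOn N e f) : PolyOn N e (fun n i => -f n i) := by
  simpa using const_mul (-1) hf

theorem mul (hf : PolyOn N e f) (hg : PolyOn N e' g) :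
    PolyOn N (e + e') (fun n i => f n i * g n i) := by
  obtain ⟨F, hF, hF'⟩ := hf
  obtain ⟨G, hG, hG'⟩ := hg
  exact ⟨F * G, polyFun.mul hF hG, fun n i h1 h2 h3 => by
    simp [hF' n i h1 h2 h3, hG' n i h1 h2 h3]⟩

theorem sum {ι : Type*} (s : Finset ι) {f : ι → ℕ → ℕ → ℚ} (h : ∀ x ∈ s, PolyOn N e (f x)) :
    PolyOn N e (fun n i => ∑ x ∈ s, f x n i) := by
  classical
  induction s using Finset.induction_on with
  | empty => simpa using zero
  | insert a s ha ih =>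
    simp only [Finset.sum_insert ha]
    exact add (h a (Finset.mem_insert_self a s)) (ih fun x hx => h x (Finset.mem_insert_of_mem hx))

theorem term (c : ℚ) (α β : ℕ) (h : 2 * ((α : ℤ) + β) ≤ e) :
    PolyOn N e (fun n i => c * ((n : ℚ) ^ α * (i : ℚ) ^ β)) :=
  const_mul c ⟨_, polyFun.monomial α β h, fun _ _ _ _ _ => rfl⟩

theorem powN (c : ℚ) (α : ℕ) (h : 2 * (α : ℤ) ≤ e) :
    PolyOn N e (fun n _ => c * (n : ℚ) ^ α) := by
  simpa using term c α 0 (by simpa using h)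

theorem const (c : ℚ) (h : 0 ≤ e) : PolyOn N e (fun _ _ => c) := by
  simpa using powN c 0 (by simpa using h)

/-- No monomial has negative degree. This later forces the first central moments to vanish exactly.
-/
theorem zero_of_neg (hf : PolyOn N e f) (he : e < 0) :
    ∀ n i : ℕ, N ≤ n → 1 ≤ i → i ≤ n → f n i = 0 := by
  obtain ⟨F, hF, hF'⟩ := hf
  have : polyFun e = ⊥ := by
    rw [polyFun, Submodule.span_eq_bot]
    rintro _ ⟨α, β, h, rfl⟩
    omega
  rw [this, Submodule.mem_bot] at hF
  intro n i h1 h2 h3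
  simp [hF' n i h1 h2 h3, hF]

theorem mean (hf : PolyOn N e f) (_hN : 1 ≤ N) :
    PolyOn N e (fun n _ => letterMean f n) := by
  obtain ⟨F, hF, hF'⟩ := hf
  obtain ⟨G, hG, hG'⟩ := polyFun_letterSum hF
  refine ⟨G, hG, fun n i h1 h2 h3 => ?_⟩
  rw [← hG' n i (by omega)]
  simp only [letterMean]
  congr 1
  refine sum_congr rfl fun k hk => ?_
  rw [mem_Ico] at hk
  exact hF' n k h1 hk.1 (by omega)

/-- A function of `n` whose differences are polynomial is polynomial. -/
theorem of_difference {h : ℕ → ℚ} (hh : PolyOn 2 e (fun n _ => h n - h (n - 1)))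
    (he : 0 ≤ e + 2) : PolyOn 1 (e + 2) (fun n _ => h n) := by
  obtain ⟨F, hF, hF'⟩ := hh
  obtain ⟨G, hG, hG'⟩ := polyFun_partialSum hF
  refine ⟨G + fun _ _ => h 1 - F 1 1, Submodule.add_mem _ hG (polyFun.const _ he), ?_⟩
  intro n i hn _ _
  clear * - hn hF' hG'
  simp only [Pi.add_apply, ← hG' n i hn]
  induction n, hn using Nat.le_induction with
  | base => simp
  | succ n hn ih =>
    rw [Finset.sum_Ico_succ_top (by omega), add_right_comm, ← ih,
      ← hF' (n + 1) 1 (by omega) le_rfl (by omega)]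
    simp

/-- A function that is polynomial for `2 ≤ n` is polynomial if its mean over `i` is. -/
theorem of_two (hf : PolyOn 2 e f) (hm : PolyOn 1 e' (fun n _ => letterMean f n)) :
    PolyOn 1 e f := by
  obtain ⟨F, hF, hF'⟩ := hf
  obtain ⟨G, hG, hG'⟩ := hm
  obtain ⟨H, hH, hH'⟩ := polyFun_letterSum hF
  obtain ⟨P, hP⟩ := polyFun_exists_polynomial hG
  obtain ⟨Q, hQ⟩ := polyFun_exists_polynomial hH
  have hmean : ∀ n : ℕ, 2 ≤ n → P.eval (n : ℚ) = Q.eval (n : ℚ) := by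
    intro n hn
    rw [← hP, ← hQ, ← hG' n 1 (by omega) le_rfl (by omega), ← hH' n 1 (by omega)]
    simp only [letterMean]
    congr 1
    refine sum_congr rfl fun k hk => ?_
    rw [mem_Ico] at hk
    exact hF' n k hn hk.1 (by omega)
  -- The two means agree for all `n ≥ 2`, hence identically; at `n = 1` a mean is the single value
  -- at `i = 1`.
  have hPQ : P = Q := by
    refine Polynomial.eq_of_infinite_eval_eq P Q ?_
    have hinf : (Set.range fun n : ℕ => ((n + 2 : ℕ) : ℚ)).Infinite :=
      Set.infinite_range_of_injective fun a b hab => by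
        simp only [Nat.cast_inj] at hab
        omega
    refine hinf.mono ?_
    rintro _ ⟨n, rfl⟩
    exact hmean (n + 2) (by omega)
  have h1 : f 1 1 = F 1 1 := by
    have e1 := hG' 1 1 le_rfl le_rfl le_rfl
    have e2 := hH' 1 1 le_rfl
    rw [hP, hPQ, ← hQ, ← e2] at e1
    simpa [letterMean] using e1
  refine ⟨F, hF, fun n i hn hi hin => ?_⟩
  rcases Nat.lt_or_ge n 2 with h | h
  · obtain rfl : n = 1 := by omega
    obtain rfl : i = 1 := by omega
    exact h1
  · exact hF' n i h hi hin

end PolyOn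

/-! ### Step averages preserve polynomiality -/

theorem stepAverage_sub (p q : ℕ) (f g : ℕ → ℕ → ℚ) (n i : ℕ) :
    stepAverage p q (fun n i => f n i - g n i) n i =
      stepAverage p q f n i - stepAverage p q g n i := by
  simp only [stepAverage, mul_sub, Finset.sum_sub_distrib, sub_div]

theorem stepAverage_const_mul (p q : ℕ) (c : ℚ) (f : ℕ → ℕ → ℚ) (n i : ℕ) :
    stepAverage p q (fun n i => c * f n i) n i = c * stepAverage p q f n i := by
  simp only [stepAverage, mul_div_assoc', Finset.mul_sum]
  congr 1
  refine sum_congr rfl fun j _ => ?_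
  ring

theorem stepAverage_mul_left (p q : ℕ) (h : ℕ → ℚ) (f : ℕ → ℕ → ℚ) (n i : ℕ) :
    stepAverage p q (fun n i => h n * f n i) n i = h (n - 1) * stepAverage p q f n i := by
  simp only [stepAverage, mul_div_assoc', Finset.mul_sum]
  congr 1
  refine sum_congr rfl fun j _ => ?_
  ring

/-- The two branches of `majStep` differ by `n - 1`, so the difference of their powers carries that
factor. -/
theorem majStep_pow (n i j q : ℕ) :
    majStep n i j ^ q = ((i : ℚ) - j - n / 2) ^ q +
      if i ≤ j then ((n : ℚ) - 1) * ∑ l ∈ range q,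
        ((i : ℚ) - j + n / 2 - 1) ^ l * ((i : ℚ) - j - n / 2) ^ (q - 1 - l) else 0 := by
  rw [majStep]
  split_ifs with h
  · have := (Commute.all ((i : ℚ) - j + n / 2 - 1) ((i : ℚ) - j - n / 2)).mul_geom_sum₂ q
    rw [show (i : ℚ) - j + n / 2 - 1 - (i - j - n / 2) = n - 1 by ring] at this
    rw [this]; ring
  · simp

/-- The jump at `j = i` contributes a tail sum in which the factor `n - 1` cancels the denominator.
What is still divided by `n - 1` is a sum over all `j`, where the division is exact. -/
theorem stepAverage_eq {n i : ℕ} (hn : 2 ≤ n) (hi : 1 ≤ i) (p q : ℕ) (f : ℕ → ℕ → ℚ) :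
    stepAverage p q f n i =
      (∑ j ∈ Ico 1 n, invStep n j ^ p * ((i : ℚ) - j - n / 2) ^ q * f (n - 1) j) / ((n : ℚ) - 1) +
      ∑ j ∈ Ico i n, invStep n j ^ p * (∑ l ∈ range q,
        ((i : ℚ) - j + n / 2 - 1) ^ l * ((i : ℚ) - j - n / 2) ^ (q - 1 - l)) * f (n - 1) j := by
  have hn1 : (n : ℚ) - 1 ≠ 0 := by
    have : (2 : ℚ) ≤ n := by exact_mod_cast hn
    linarith
  have hI : Ico i n = (Ico 1 n).filter (fun j => i ≤ j) := by
    ext j; simp only [mem_Ico, mem_filter]; omega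
  rw [stepAverage, div_eq_iff hn1, add_mul, div_mul_cancel₀ _ hn1, hI, Finset.sum_filter,
    Finset.sum_mul, ← Finset.sum_add_distrib]
  refine sum_congr rfl fun j _ => ?_
  rw [majStep_pow]
  split_ifs <;> ring

/-- In the tail sum the cofactor has degree only `q - 1`, which makes up for the degree gained by
summing. -/
theorem PolyOn.step {e : ℤ} {f : ℕ → ℕ → ℚ} (hf : PolyOn 1 e f) (p q : ℕ) :
    PolyOn 2 (e + 2 * ((p : ℤ) + q)) (stepAverage p q f) := by
  obtain ⟨F, hF, hF'⟩ := hf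
  obtain ⟨G, hG, hG'⟩ := polyFun₃.of_polyFun hF
  have ha : (fun (n _ j : ℕ) => (n : ℚ) / 2 - j) ∈ polyFun₃ 2 := by
    refine Submodule.sub_mem _ ?_ polyFun₃.var_j
    have := (polyFun₃ 2).smul_mem (1 / 2) polyFun₃.var_n
    convert this using 1
    funext n i j
    simp; ring
  have hb : (fun (n i j : ℕ) => (i : ℚ) - j - n / 2) ∈ polyFun₃ 2 := by
    refine Submodule.sub_mem _ (Submodule.sub_mem _ polyFun₃.var_i polyFun₃.var_j) ?_
    have := (polyFun₃ 2).smul_mem (1 / 2) polyFun₃.var_n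
    convert this using 1
    funext n i j
    simp; ring
  have hc : (fun (n i j : ℕ) => (i : ℚ) - j + n / 2 - 1) ∈ polyFun₃ 2 := by
    refine Submodule.sub_mem _ (Submodule.add_mem _ (Submodule.sub_mem _ polyFun₃.var_i
      polyFun₃.var_j) ?_) (polyFun₃.const 1 (by norm_num))
    have := (polyFun₃ 2).smul_mem (1 / 2) polyFun₃.var_n
    convert this using 1
    funext n i j
    simp; ring
  have hq : (∑ l ∈ range q, (fun (n i j : ℕ) => (i : ℚ) - j + n / 2 - 1) ^ l *
      (fun (n i j : ℕ) => (i : ℚ) - j - n / 2) ^ (q - 1 - l)) ∈ polyFun₃ (2 * q - 2) := by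
    refine Submodule.sum_mem _ fun l hl => ?_
    rw [mem_range] at hl
    exact polyFun₃.mono (by omega) (polyFun₃.mul (polyFun₃.pow hc l) (polyFun₃.pow hb (q - 1 - l)))
  obtain ⟨U, hU, hU'⟩ := polyFun_average
    (polyFun₃.mul (polyFun₃.mul (polyFun₃.pow ha p) (polyFun₃.pow hb q)) hG)
  obtain ⟨V, hV, hV'⟩ := polyFun_tailSum
    (polyFun₃.mul (polyFun₃.mul (polyFun₃.pow ha p) hq) hG)
  refine ⟨U + V, Submodule.add_mem _ (polyFun.mono (by linarith) hU)
    (polyFun.mono (by linarith) hV), fun n i hn hi hin => ?_⟩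
  rw [stepAverage_eq hn hi, Pi.add_apply, Pi.add_apply, ← hU' n i hn, ← hV' n i hin]
  simp only [Pi.mul_apply, Pi.pow_apply, Finset.sum_apply, invStep]
  congr 1
  · congr 1
    refine sum_congr rfl fun j hj => ?_
    rw [mem_Ico] at hj
    rw [hF' (n - 1) j (by omega) hj.1 (by omega), hG' n i j (by omega)]
  · refine sum_congr rfl fun j hj => ?_
    rw [mem_Ico] at hj
    rw [hF' (n - 1) j (by omega) (by omega) (by omega), hG' n i j (by omega)]

/-! ### Separating the main terms of the recurrence -/

/-- The remaining terms of a double sum, when those in `S` are set apart. -/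
theorem PolyOn.double_sum_sub {N : ℕ} {e : ℤ} {a b : ℕ} (S : Finset (ℕ × ℕ))
    (T : ℕ × ℕ → ℕ → ℕ → ℚ) (hT : ∀ x, a < x.1 ∨ b < x.2 → T x = 0)
    (h : ∀ p q : ℕ, (p, q) ∉ S → p ≤ a → q ≤ b → PolyOn N e (T (p, q))) :
    PolyOn N e (fun n i => ∑ p ∈ range (a + 1), ∑ q ∈ range (b + 1), T (p, q) n i -
      ∑ x ∈ S, T x n i) := by
  classical
  have h1 : PolyOn N e (fun n i => ∑ x ∈ (range (a + 1) ×ˢ range (b + 1)) \ S, T x n i) := by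
    refine PolyOn.sum _ fun x hx => ?_
    simp only [mem_sdiff, mem_product, mem_range] at hx
    exact h x.1 x.2 hx.2 (by omega) (by omega)
  refine h1.congr fun n i _ _ _ => ?_
  rw [← Finset.sum_product', sub_eq_iff_eq_add]
  have h2 : ∑ x ∈ S, T x n i = ∑ x ∈ S ∩ (range (a + 1) ×ˢ range (b + 1)), T x n i := by
    symm
    refine Finset.sum_subset Finset.inter_subset_left fun x hx hx' => ?_
    simp only [mem_inter, mem_product, mem_range, hx, true_and, not_and_or, not_lt] at hx'
    rw [hT x (by omega)]
    rfl
  rw [h2, Finset.inter_comm]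
  exact ((add_comm _ _).trans (Finset.sum_inter_add_sum_sdiff _ _ _)).symm

/-- The remaining terms of the recurrence, when those in `S` are set apart. -/
theorem PolyOn.recurrence_sub {e : ℤ} (a b : ℕ) (S : Finset (ℕ × ℕ))
    (h : ∀ p q : ℕ, (p, q) ∉ S → p ≤ a → q ≤ b →
      PolyOn 2 e (stepAverage p q (centralMoment (a - p) (b - q)))) :
    PolyOn 2 e (fun n i => centralMoment a b n i - ∑ x ∈ S, (a.choose x.1 : ℚ) * (b.choose x.2 : ℚ) *
      stepAverage x.1 x.2 (centralMoment (a - x.1) (b - x.2)) n i) := by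
  refine (PolyOn.double_sum_sub (a := a) (b := b) S (fun x n i =>
    (a.choose x.1 : ℚ) * (b.choose x.2 : ℚ) *
      stepAverage x.1 x.2 (centralMoment (a - x.1) (b - x.2)) n i) ?_ ?_).congr
    fun n i hn hi hin => by rw [centralMoment_recurrence a b hn hi hin]
  · rintro x (hx | hx) <;> funext n i <;> simp [Nat.choose_eq_zero_of_lt hx]
  · intro p q hpq hp hq
    exact (h p q hpq hp hq).const_mul _

/-! ### Moments of the steps -/

/-- The mixed moments of the two steps for a uniform last but one letter. -/
def stepMoment (p q n i : ℕ) : ℚ := stepAverage p q (fun _ _ => 1) n i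

theorem sum_Ico_telescope {g G : ℚ → ℚ} (hG : ∀ u, G (u - 1) - G u = g u) (c : ℚ) {i m : ℕ}
    (h : i ≤ m) : ∑ j ∈ Ico i m, g (c - j) = G (c - m) - G (c - i) := by
  induction m, h using Nat.le_induction with
  | base => simp
  | succ m hm ih =>
    rw [Finset.sum_Ico_succ_top hm, ih, ← hG]
    push_cast
    rw [sub_sub c]
    ring

theorem sum_invStep_one (c : ℚ) {i m : ℕ} (h : i ≤ m) : ∑ j ∈ Ico i m, (c - j) =
    (c - i) * (c - i + 1) / 2 - (c - m) * (c - m + 1) / 2 := by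
  rw [sum_Ico_telescope (g := fun u => u) (G := fun u => -(u * (u + 1) / 2))
    (fun u => by ring) c h]
  ring

theorem sum_invStep_two (c : ℚ) {i m : ℕ} (h : i ≤ m) : ∑ j ∈ Ico i m, (c - j) ^ 2 =
    (c - i) * (c - i + 1) * (2 * (c - i) + 1) / 6 -
      (c - m) * (c - m + 1) * (2 * (c - m) + 1) / 6 := by
  rw [sum_Ico_telescope (g := fun u => u ^ 2) (G := fun u => -(u * (u + 1) * (2 * u + 1) / 6))
    (fun u => by ring) c h]
  ring

theorem sum_invStep_three (c : ℚ) {i m : ℕ} (h : i ≤ m) : ∑ j ∈ Ico i m, (c - j) ^ 3 =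
    ((c - i) * (c - i + 1)) ^ 2 / 4 - ((c - m) * (c - m + 1)) ^ 2 / 4 := by
  rw [sum_Ico_telescope (g := fun u => u ^ 3) (G := fun u => -((u * (u + 1)) ^ 2 / 4))
    (fun u => by ring) c h]
  ring

theorem sum_invStep_four (c : ℚ) {i m : ℕ} (h : i ≤ m) : ∑ j ∈ Ico i m, (c - j) ^ 4 =
    (c - i) * (c - i + 1) * (2 * (c - i) + 1) * (3 * (c - i) ^ 2 + 3 * (c - i) - 1) / 30 -
      (c - m) * (c - m + 1) * (2 * (c - m) + 1) * (3 * (c - m) ^ 2 + 3 * (c - m) - 1) / 30 := by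
  rw [sum_Ico_telescope (g := fun u => u ^ 4)
    (G := fun u => -(u * (u + 1) * (2 * u + 1) * (3 * u ^ 2 + 3 * u - 1) / 30))
    (fun u => by ring) c h]
  ring

theorem cast_sub_one_ne_zero {n : ℕ} (hn : 2 ≤ n) : (n : ℚ) - 1 ≠ 0 := by
  have : (2 : ℚ) ≤ n := by exact_mod_cast hn
  linarith

/-- The values `n / 2 - j` are symmetric about 0, so odd moments vanish. -/
theorem stepMoment_one_zero {n : ℕ} (hn : 2 ≤ n) (i : ℕ) : stepMoment 1 0 n i = 0 := by
  simp only [stepMoment, stepAverage, invStep, pow_one, pow_zero, mul_one]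
  rw [sum_invStep_one _ (by omega : 1 ≤ n)]
  push_cast; ring

theorem stepMoment_two_zero {n : ℕ} (hn : 2 ≤ n) (i : ℕ) :
    stepMoment 2 0 n i = n * (n - 2) / 12 := by
  simp only [stepMoment, stepAverage, invStep, pow_zero, mul_one]
  rw [sum_invStep_two _ (by omega : 1 ≤ n), div_eq_iff (cast_sub_one_ne_zero hn)]
  push_cast; ring

theorem stepMoment_three_zero {n : ℕ} (hn : 2 ≤ n) (i : ℕ) : stepMoment 3 0 n i = 0 := by
  simp only [stepMoment, stepAverage, invStep, pow_zero, mul_one]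
  rw [sum_invStep_three _ (by omega : 1 ≤ n)]
  push_cast; ring

theorem stepMoment_four_zero {n : ℕ} (hn : 2 ≤ n) (i : ℕ) :
    stepMoment 4 0 n i = n * (n - 2) * (3 * n ^ 2 - 6 * n - 4) / 240 := by
  simp only [stepMoment, stepAverage, invStep, pow_zero, mul_one]
  rw [sum_invStep_four _ (by omega : 1 ≤ n), div_eq_iff (cast_sub_one_ne_zero hn)]
  push_cast; ring

/-- For a fixed last letter the steps of the major index are a rearrangement of the steps of the
number of inversions. -/
theorem sum_majStep {n i : ℕ} (hi : 1 ≤ i) (hin : i ≤ n) (F : ℚ → ℚ) :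
    ∑ j ∈ Ico 1 n, F (majStep n i j) = ∑ l ∈ Ico 1 n, F (invStep n l) := by
  refine Finset.sum_nbij' (fun j => if j < i then n + j - i else 1 + j - i)
    (fun l => if l ≤ n - i then l + i - 1 else l + i - n) ?_ ?_ ?_ ?_ ?_
  · intro j hj
    simp only [mem_Ico] at hj ⊢
    split_ifs <;> omega
  · intro j hj
    simp only [mem_Ico] at hj ⊢
    split_ifs <;> omega
  · intro j hj
    simp only [mem_Ico] at hj ⊢
    split_ifs <;> omega
  · intro j hj
    simp only [mem_Ico] at hj ⊢
    split_ifs <;> omega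
  · intro j hj
    simp only [mem_Ico] at hj ⊢
    congr 1
    simp only [majStep, invStep]
    by_cases h : j < i
    · rw [if_neg (by omega), if_pos h, Nat.cast_sub (by omega)]
      push_cast; ring
    · rw [if_pos (by omega), if_neg h, Nat.cast_sub (by omega)]
      push_cast; ring

theorem stepMoment_zero_left {n i : ℕ} (hi : 1 ≤ i) (hin : i ≤ n) (q : ℕ) :
    stepMoment 0 q n i = stepMoment q 0 n i := by
  simp only [stepMoment, stepAverage, pow_zero, mul_one, one_mul]
  rw [sum_majStep hi hin (fun u => u ^ q)]

/-- The steps of the major index for a fixed last but one letter. -/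
theorem sum_majStep_left {n j : ℕ} (hj : 1 ≤ j) (hjn : j < n) (F : ℚ → ℚ) :
    ∑ i ∈ Ico 1 (n + 1), F (majStep n i j) = ∑ l ∈ Ico 1 n, F (invStep n l) + F (invStep n j) := by
  have h1 : ∑ i ∈ Ico 1 (j + 1), F (majStep n i j) = ∑ l ∈ Ico 1 (j + 1), F (invStep n l) := by
    refine Finset.sum_nbij' (fun i => 1 + j - i) (fun l => 1 + j - l) ?_ ?_ ?_ ?_ ?_
    · intro i hi; simp only [mem_Ico] at hi ⊢; omega
    · intro i hi; simp only [mem_Ico] at hi ⊢; omega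
    · intro i hi; simp only [mem_Ico] at hi ⊢; omega
    · intro i hi; simp only [mem_Ico] at hi ⊢; omega
    · intro i hi
      simp only [mem_Ico] at hi ⊢
      congr 1
      simp only [majStep, invStep]
      rw [if_pos (by omega), Nat.cast_sub (by omega)]
      push_cast; ring
  have h2 : ∑ i ∈ Ico (j + 1) (n + 1), F (majStep n i j) = ∑ l ∈ Ico j n, F (invStep n l) := by
    refine Finset.sum_nbij' (fun i => n + j - i) (fun l => n + j - l) ?_ ?_ ?_ ?_ ?_
    · intro i hi; simp only [mem_Ico] at hi ⊢; omega
    · intro i hi; simp only [mem_Ico] at hi ⊢; omega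
    · intro i hi; simp only [mem_Ico] at hi ⊢; omega
    · intro i hi; simp only [mem_Ico] at hi ⊢; omega
    · intro i hi
      simp only [mem_Ico] at hi ⊢
      congr 1
      simp only [majStep, invStep]
      rw [if_neg (by omega), Nat.cast_sub (by omega)]
      push_cast; ring
  rw [← Finset.sum_Ico_consecutive _ (show 1 ≤ j + 1 by omega) (show j + 1 ≤ n + 1 by omega),
    ← Finset.sum_Ico_consecutive (fun l => F (invStep n l)) (show 1 ≤ j + 1 by omega) hjn, h1, h2,
    Finset.sum_eq_sum_Ico_succ_bot hjn]
  ring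

/-- Summing over `i` first, `sum_majStep_left` replaces powers of `majStep` by powers of `invStep`:
a product, plus a diagonal term from the repeated value. The result does not depend on `i`, which
may be any letter. -/
theorem letterMean_stepAverage {n : ℕ} (hn : 2 ≤ n) (i p q : ℕ) (f : ℕ → ℕ → ℚ) :
    letterMean (stepAverage p q f) n =
      (((n : ℚ) - 1) * stepMoment q 0 n i * stepAverage p 0 f n i +
        stepAverage (p + q) 0 f n i) / n := by
  have hn1 := cast_sub_one_ne_zero hn
  simp only [letterMean, stepMoment, stepAverage, pow_zero, mul_one]
  rw [mul_div_cancel₀ _ hn1, ← Finset.sum_div, mul_div_assoc', ← add_div]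
  congr 2
  rw [Finset.sum_comm, Finset.mul_sum, ← Finset.sum_add_distrib]
  refine sum_congr rfl fun j hj => ?_
  rw [mem_Ico] at hj
  rw [← Finset.sum_mul, ← Finset.mul_sum, sum_majStep_left hj.1 hj.2 (fun u => u ^ q), pow_add]
  ring

theorem stepMoment_one_one {n i : ℕ} (hn : 2 ≤ n) (hi : 1 ≤ i) (hin : i ≤ n) :
    stepMoment 1 1 n i = n * (n - 2) / 12 - (n - i) * (i - 1) / 2 := by
  have h0 : ∀ j ∈ Ico 1 n, invStep n j ^ 1 * ((i : ℚ) - j - n / 2) ^ 1 * 1 =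
      ((n : ℚ) / 2 - j) ^ 2 + ((i : ℚ) - n) * ((n : ℚ) / 2 - j) := fun j _ => by
    rw [invStep]; ring
  rw [stepMoment, stepAverage_eq hn hi, sum_congr rfl h0, Finset.sum_add_distrib, ← Finset.mul_sum,
    sum_invStep_one _ (by omega : 1 ≤ n), sum_invStep_two _ (by omega : 1 ≤ n)]
  simp only [invStep, Finset.sum_range_one, Nat.sub_self, pow_zero, pow_one, mul_one]
  rw [sum_invStep_one _ hin]
  have hn1 := cast_sub_one_ne_zero hn
  push_cast
  field_simp
  ring

theorem stepMoment_two_one {n i : ℕ} (hn : 2 ≤ n) (hi : 1 ≤ i) (hin : i ≤ n) :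
    stepMoment 2 1 n i = -(i * (n - i) * (n - 2 * i)) / 6 +
      (n ^ 2 / 6 - 2 * n * i / 3 + i ^ 2 / 2 + n / 6 - i / 6) := by
  have h0 : ∀ j ∈ Ico 1 n, invStep n j ^ 2 * ((i : ℚ) - j - n / 2) ^ 1 * 1 =
      ((n : ℚ) / 2 - j) ^ 3 + ((i : ℚ) - n) * ((n : ℚ) / 2 - j) ^ 2 := fun j _ => by
    rw [invStep]; ring
  rw [stepMoment, stepAverage_eq hn hi, sum_congr rfl h0, Finset.sum_add_distrib, ← Finset.mul_sum,
    sum_invStep_three _ (by omega : 1 ≤ n), sum_invStep_two _ (by omega : 1 ≤ n)]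
  simp only [invStep, Finset.sum_range_one, Nat.sub_self, pow_zero, mul_one]
  rw [sum_invStep_two _ hin]
  have hn1 := cast_sub_one_ne_zero hn
  push_cast
  field_simp
  ring

/-- The exact antisymmetry behind the cancellation in `odd_even_step`. -/
theorem stepMoment_one_two {n i : ℕ} (hn : 2 ≤ n) (hi : 1 ≤ i) (hin : i ≤ n) :
    stepMoment 1 2 n i = -stepMoment 2 1 n i := by
  have h0 : ∀ j ∈ Ico 1 n, invStep n j ^ 1 * ((i : ℚ) - j - n / 2) ^ 2 * 1 =
      ((n : ℚ) / 2 - j) ^ 3 + 2 * ((i : ℚ) - n) * ((n : ℚ) / 2 - j) ^ 2 +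
        ((i : ℚ) - n) ^ 2 * ((n : ℚ) / 2 - j) := fun j _ => by
    rw [invStep]; ring
  have h1 : ∀ j ∈ Ico i n, invStep n j ^ 1 * (∑ l ∈ range 2,
        ((i : ℚ) - j + n / 2 - 1) ^ l * ((i : ℚ) - j - n / 2) ^ (2 - 1 - l)) * 1 =
      2 * ((n : ℚ) / 2 - j) ^ 2 + (2 * i - n - 1) * ((n : ℚ) / 2 - j) := fun j _ => by
    simp only [Finset.sum_range_succ, Finset.sum_range_zero, invStep]
    norm_num
    ring
  rw [stepMoment_two_one hn hi hin, stepMoment, stepAverage_eq hn hi, sum_congr rfl h0,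
    sum_congr rfl h1]
  simp only [Finset.sum_add_distrib, ← Finset.mul_sum]
  rw [sum_invStep_three _ (by omega : 1 ≤ n), sum_invStep_two _ (by omega : 1 ≤ n),
    sum_invStep_one _ (by omega : 1 ≤ n), sum_invStep_two _ hin, sum_invStep_one _ hin]
  have hn1 := cast_sub_one_ne_zero hn
  push_cast
  field_simp
  ring

/-! ### Leading shapes and leading coefficients -/

/-- The shape of the leading part of the moments with two odd orders. -/
def oddShape (n i : ℕ) : ℚ := (n - 2 * i) ^ 2

/-- The shape of the leading part of the moments with one odd order. -/
def cubicShape (n i : ℕ) : ℚ := i * (n - i) * (n - 2 * i)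

theorem stepAverage_one (p q n i : ℕ) :
    stepAverage p q (fun _ _ => 1) n i = stepMoment p q n i := rfl

theorem stepAverage_oddShape {n : ℕ} (hn : 2 ≤ n) (p q i : ℕ) :
    stepAverage p q oddShape n i =
      4 * stepMoment (p + 2) q n i - 4 * stepMoment (p + 1) q n i + stepMoment p q n i := by
  simp only [stepMoment, stepAverage, mul_div_assoc', Finset.mul_sum]
  rw [← sub_div, ← add_div, ← Finset.sum_sub_distrib, ← Finset.sum_add_distrib]
  congr 1
  refine sum_congr rfl fun j _ => ?_
  rw [oddShape, Nat.cast_sub (by omega), invStep]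
  push_cast
  ring

/-- With u = `invStep n j`, the shape at `(n - 1, j)` is (n/2 - u)(n/2 + u - 1)(2u - 1), a cubic in
u. -/
theorem stepAverage_cubicShape {n : ℕ} (hn : 2 ≤ n) (p q i : ℕ) :
    stepAverage p q cubicShape n i =
      -(2 * stepMoment (p + 3) q n i) + 3 * stepMoment (p + 2) q n i +
        (n * (n - 2) / 2 - 1) * stepMoment (p + 1) q n i - n * (n - 2) / 4 * stepMoment p q n i := by
  simp only [stepMoment, stepAverage, mul_div_assoc', Finset.mul_sum]
  rw [← neg_div, ← add_div, ← add_div, ← sub_div, ← Finset.sum_neg_distrib,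
    ← Finset.sum_add_distrib, ← Finset.sum_add_distrib, ← Finset.sum_sub_distrib]
  congr 1
  refine sum_congr rfl fun j _ => ?_
  rw [cubicShape, Nat.cast_sub (by omega), invStep]
  push_cast
  ring

theorem PolyOn.pow_difference (d : ℕ) : PolyOn 1 (2 * (d : ℤ) - 2)
    (fun n _ => (n : ℚ) ^ d - ((n - 1 : ℕ) : ℚ) ^ d) ∧
    PolyOn 1 (2 * (d : ℤ) - 4)
    (fun n _ => (n : ℚ) ^ d - ((n - 1 : ℕ) : ℚ) ^ d - d * (n : ℚ) ^ (d - 1)) := by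
  induction d with
  | zero =>
    exact ⟨PolyOn.zero.congr fun n i _ _ _ => by simp, PolyOn.zero.congr fun n i _ _ _ => by simp⟩
  | succ d ih =>
    have h2 : PolyOn 1 (2 * ((d + 1 : ℕ) : ℤ) - 4) (fun n _ =>
        (n : ℚ) ^ (d + 1) - ((n - 1 : ℕ) : ℚ) ^ (d + 1) -
          (d + 1 : ℕ) * (n : ℚ) ^ (d + 1 - 1)) := by
      have hn : PolyOn 1 2 (fun n _ => (n : ℚ)) := by
        simpa using PolyOn.powN (N := 1) (e := 2) 1 1 (by norm_num)
      -- From n^(d+1) - (n-1)^(d+1) = n(n^d - (n-1)^d) - (n^d - (n-1)^d) + n^d.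
      have h3 := ((hn.mul ih.2).mono (e' := 2 * ((d + 1 : ℕ) : ℤ) - 4) (by push_cast; linarith)).sub
        (ih.1.mono (by push_cast; linarith))
      refine h3.congr fun n i hn _ _ => ?_
      rw [Nat.cast_sub hn]
      push_cast
      rcases d with _ | d
      · simp
      · simp only [Nat.add_sub_cancel]
        push_cast
        ring
    refine ⟨?_, h2⟩
    refine ((h2.mono (e' := 2 * ((d + 1 : ℕ) : ℤ) - 2) (by linarith)).add
      (PolyOn.powN ((d + 1 : ℕ) : ℚ) (d + 1 - 1) (by push_cast; omega))).congr
      fun n i _ _ _ => by ring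

/-- The leading coefficient of the central moment of orders `2 r` and `2 s`. -/
def momentCoeff (r s : ℕ) : ℚ := momentConst r s * (1 / 36) ^ (r + s)

theorem double_factorial_step (r : ℕ) :
    (((2 * (r + 1)).factorial : ℚ) / (2 ^ (r + 1) * ((r + 1).factorial : ℚ))) =
      (2 * r + 1) * (((2 * r).factorial : ℚ) / (2 ^ r * (r.factorial : ℚ))) := by
  rw [show 2 * (r + 1) = 2 * r + 1 + 1 by ring, Nat.factorial_succ, Nat.factorial_succ,
    Nat.factorial_succ]
  have : (r.factorial : ℚ) ≠ 0 := by positivity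
  have : (r : ℚ) + 1 ≠ 0 := by positivity
  push_cast
  field_simp
  ring

/-- The Gaussian moment recursion for variance 1/36; it matches the recurrence to the derivative of
the leading power. -/
theorem momentCoeff_succ_left (r s : ℕ) :
    (2 * r + 1) * momentCoeff r s = 36 * momentCoeff (r + 1) s := by
  simp only [momentCoeff, momentConst, double_factorial_step]
  rw [show r + 1 + s = r + s + 1 by ring, pow_succ]
  ring

theorem momentCoeff_succ_right (r s : ℕ) :
    (2 * s + 1) * momentCoeff r s = 36 * momentCoeff r (s + 1) := by
  simp only [momentCoeff, momentConst, double_factorial_step]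
  rw [show r + (s + 1) = r + s + 1 by ring, pow_succ]
  ring

theorem momentCoeff_zero : momentCoeff 0 0 = 1 := by
  simp [momentCoeff, momentConst]

/-! ### The induction hypothesis and its consequences for step averages -/

/-- The asymptotic form of the central moments of total order less than `K`. -/
structure MomentAsymptotics (K : ℕ) : Prop where
  even_even : ∀ r s : ℕ, 2 * r + 2 * s < K → PolyOn 1 (6 * (r : ℤ) + 6 * s - 2)
    (fun n i => centralMoment (2 * r) (2 * s) n i - momentCoeff r s * (n : ℚ) ^ (3 * r + 3 * s))
  -- The dependence on `i` starts one degree below the error in `even_even`. This precision is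
  -- needed wherever a step moment, or its mean over `i`, is unusually small.
  even_even_mean : ∀ r s : ℕ, 2 * r + 2 * s < K → PolyOn 1 (6 * (r : ℤ) + 6 * s - 4)
    (fun n i => centralMoment (2 * r) (2 * s) n i - letterMean (centralMoment (2 * r) (2 * s)) n)
  odd_odd : ∀ r s : ℕ, 2 * r + 2 * s + 2 < K → PolyOn 1 (6 * (r : ℤ) + 6 * s + 2)
    (fun n i => centralMoment (2 * r + 1) (2 * s + 1) n i -
      (2 * r + 1) * (2 * s + 1) * momentCoeff r s / 8 *
        ((n : ℚ) ^ (3 * r + 3 * s) * oddShape n i))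
  even_odd : ∀ r s : ℕ, 2 * r + 2 * s + 1 < K → PolyOn 1 (6 * (r : ℤ) + 6 * s - 2)
    (fun n i => centralMoment (2 * r) (2 * s + 1) n i -
      -(6 * r * (2 * s + 1) * momentCoeff r s) *
        ((n : ℚ) ^ (3 * r + 3 * s - 3) * cubicShape n i))
  odd_even : ∀ r s : ℕ, 2 * r + 2 * s + 1 < K → PolyOn 1 (6 * (r : ℤ) + 6 * s - 2)
    (centralMoment (2 * r + 1) (2 * s))

/-- Twice the difference between `3 / 2 * (a + b)` and the degree of the central moment of orders
`a` and `b`. -/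
def degreeDrop (a b : ℕ) : ℤ :=
  if a % 2 = b % 2 then (if a % 2 = 0 then 0 else 2) else 3

namespace PolyOn

variable {N : ℕ}

theorem linear (a b c : ℚ) : PolyOn N 2 (fun n i => a * n + b * i + c) :=
  ((((term a 1 0 (by norm_num)).add (term b 0 1 (by norm_num))).add
    (term c 0 0 (by norm_num))).congr fun n i _ _ _ => by simp)

theorem quadratic (a b c d e f : ℚ) :
    PolyOn N 4 (fun n i => a * n ^ 2 + b * (n * i) + c * i ^ 2 + d * n + e * i + f) :=
  ((((((term a 2 0 (by norm_num)).add (term b 1 1 (by norm_num))).add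
    (term c 0 2 (by norm_num))).add (term d 1 0 (by norm_num))).add
    (term e 0 1 (by norm_num))).add (term f 0 0 (by norm_num))).congr fun n i _ _ _ => by simp

theorem cubicN (a b c d : ℚ) : PolyOn N 6 (fun n _ => a * n ^ 3 + b * n ^ 2 + c * n + d) :=
  ((((powN a 3 (by norm_num)).add (powN b 2 (by norm_num))).add (powN c 1 (by norm_num))).add
    (powN d 0 (by norm_num))).congr fun n i _ _ _ => by simp

theorem oddShape : PolyOn N 4 oddShape :=
  (quadratic 1 (-4) 4 0 0 0).congr fun n i _ _ _ => by rw [_root_.oddShape]; ring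

theorem cubicShape : PolyOn N 6 cubicShape :=
  (((term 1 2 1 (by norm_num)).add (term (-3) 1 2 (by norm_num))).add
    (term 2 0 3 (by norm_num))).congr fun n i _ _ _ => by rw [_root_.cubicShape]; ring

theorem stepMoment (p q : ℕ) : PolyOn 2 (2 * ((p : ℤ) + q)) (stepMoment p q) :=
  ((const 1 le_rfl).step p q).mono (by linarith)

theorem shift {e : ℤ} {h : ℕ → ℚ} (hh : PolyOn 1 e (fun n _ => h n)) :
    PolyOn 2 e (fun n _ => h (n - 1)) := by
  refine ((hh.step 0 0).mono (e' := e) (by simp)).congr fun n i hn _ _ => ?_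
  have h1 : ((n - 1 : ℕ) : ℚ) = n - 1 := by rw [Nat.cast_sub (by omega)]; simp
  have h2 := cast_sub_one_ne_zero hn
  simp only [stepAverage, pow_zero, mul_one, one_mul, sum_const, Nat.card_Ico, nsmul_eq_mul, h1]
  field_simp

/-- Replacing `n - 1` by `n`, and a factor by its leading part. -/
theorem replace_leading (c : ℚ) (d : ℕ) {x : ℤ} {X Y : ℕ → ℕ → ℚ} (hX : PolyOn 2 x X)
    (hXY : PolyOn 2 (x - 2) (fun n i => X n i - Y n i)) :
    PolyOn 2 (2 * (d : ℤ) + x - 2) (fun n i =>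
      c * (((n - 1 : ℕ) : ℚ) ^ d * X n i) - c * ((n : ℚ) ^ d * Y n i)) := by
  have h1 := ((((pow_difference d).1.mono_left (N' := 2) (by norm_num)).mul hX).mono
    (e' := 2 * (d : ℤ) + x - 2) (by linarith))
  have h2 := ((powN (N := 2) (e := 2 * (d : ℤ)) 1 d le_rfl).mul hXY).mono
    (e' := 2 * (d : ℤ) + x - 2) (by linarith)
  exact ((h2.sub h1).const_mul c).congr fun n i _ _ _ => by ring

end PolyOn

theorem letterMean_const {n : ℕ} (hn : 1 ≤ n) (h : ℕ → ℚ) :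
    letterMean (fun n _ => h n) n = h n := by
  have : (n : ℚ) ≠ 0 := by positivity
  simp only [letterMean, sum_const, Nat.card_Ico, nsmul_eq_mul, Nat.add_sub_cancel]
  field_simp

theorem letterMean_sub (f g : ℕ → ℕ → ℚ) (n : ℕ) :
    letterMean (fun n i => f n i - g n i) n = letterMean f n - letterMean g n := by
  simp only [letterMean, Finset.sum_sub_distrib, sub_div]

theorem letterMean_mul_left (h : ℕ → ℚ) (f : ℕ → ℕ → ℚ) (n : ℕ) :
    letterMean (fun n i => h n * f n i) n = h n * letterMean f n := by
  simp only [letterMean, ← Finset.mul_sum, mul_div_assoc]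

theorem letterMean_congr {f g : ℕ → ℕ → ℚ} {n : ℕ} (h : ∀ i, 1 ≤ i → i ≤ n → f n i = g n i) :
    letterMean f n = letterMean g n := by
  simp only [letterMean]
  congr 1
  refine sum_congr rfl fun i hi => ?_
  rw [mem_Ico] at hi
  exact h i hi.1 (by omega)

theorem stepAverage_zero_zero {n : ℕ} (hn : 2 ≤ n) (f : ℕ → ℕ → ℚ) (i : ℕ) :
    stepAverage 0 0 f n i = letterMean f (n - 1) := by
  simp only [stepAverage, letterMean, pow_zero, one_mul]
  rw [show n - 1 + 1 = n by omega, Nat.cast_sub (by omega)]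
  simp

theorem letterMean_centralMoment_of_odd {a b : ℕ} (h : (a + b) % 2 = 1) (n : ℕ) :
    letterMean (centralMoment a b) n = 0 := by
  have h1 : ∑ i ∈ Ico 1 (n + 1), centralMoment a b n i =
      -∑ i ∈ Ico 1 (n + 1), centralMoment a b n i := by
    have hr := Finset.sum_Ico_reflect (fun i => centralMoment a b n i) 1 (Nat.le_succ (n + 1))
    rw [show n + 1 + 1 - (n + 1) = 1 by omega, show n + 1 + 1 - 1 = n + 1 by omega] at hr
    nth_rewrite 1 [← hr]
    rw [← Finset.sum_neg_distrib]
    refine sum_congr rfl fun i hi => ?_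
    rw [mem_Ico] at hi
    rw [centralMoment_reflect n a b i hi.1 (by omega),
      (Nat.odd_iff.2 h).neg_one_pow]
    ring
  rw [letterMean, show ∑ i ∈ Ico 1 (n + 1), centralMoment a b n i = 0 by linarith, zero_div]

namespace MomentAsymptotics

variable {K : ℕ}

theorem bound (h : MomentAsymptotics K) {a b : ℕ} (hab : a + b < K) :
    PolyOn 1 (3 * ((a : ℤ) + b) - degreeDrop a b) (centralMoment a b) := by
  obtain ⟨r, rfl | rfl⟩ := Nat.even_or_odd' a <;> obtain ⟨s, rfl | rfl⟩ := Nat.even_or_odd' b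
  · have h1 := h.even_even r s hab
    refine ((h1.mono (e' := 6 * (r : ℤ) + 6 * s) (by linarith)).add
      (PolyOn.powN (momentCoeff r s) (3 * r + 3 * s) (by push_cast; linarith))).mono ?_ |>.congr
      fun n i _ _ _ => by ring
    simp only [degreeDrop]; push_cast; split_ifs <;> omega
  · have h1 := h.even_odd r s (by omega)
    have h2 : PolyOn 1 (6 * (r : ℤ) + 6 * s) (fun n i =>
        -(6 * r * (2 * s + 1) * momentCoeff r s) *
        ((n : ℚ) ^ (3 * r + 3 * s - 3) * cubicShape n i)) := by
      rcases r with _ | r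
      · exact PolyOn.zero.congr fun n i _ _ _ => by simp
      · refine (((PolyOn.powN 1 (3 * (r + 1) + 3 * s - 3) le_rfl).mul PolyOn.cubicShape).const_mul
          (-(6 * (r + 1 : ℕ) * (2 * s + 1) * momentCoeff (r + 1) s))).mono ?_ |>.congr
            fun n i _ _ _ => by ring
        push_cast; omega
    refine ((h1.mono (e' := 6 * (r : ℤ) + 6 * s) (by linarith)).add h2).mono ?_ |>.congr
      fun n i _ _ _ => by ring
    simp only [degreeDrop]; push_cast; split_ifs <;> omega
  · refine (h.odd_even r s (by omega)).mono ?_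
    simp only [degreeDrop]; push_cast; split_ifs <;> omega
  · have h1 := h.odd_odd r s (by omega)
    have h2 : PolyOn 1 (6 * (r : ℤ) + 6 * s + 4) (fun n i =>
        (2 * r + 1) * (2 * s + 1) * momentCoeff r s / 8 *
        ((n : ℚ) ^ (3 * r + 3 * s) * oddShape n i)) := by
      refine (((PolyOn.powN 1 (3 * r + 3 * s) le_rfl).mul PolyOn.oddShape).const_mul
          ((2 * r + 1) * (2 * s + 1) * momentCoeff r s / 8)).mono ?_ |>.congr
            fun n i _ _ _ => by ring
      push_cast; omega
    refine ((h1.mono (e' := 6 * (r : ℤ) + 6 * s + 4) (by linarith)).add h2).mono ?_ |>.congr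
      fun n i _ _ _ => by ring
    simp only [degreeDrop]; push_cast; split_ifs <;> omega

/-- Lowering the order by p + q costs 3(p + q) in doubled degree, and the steps restore 2(p + q). So
the term (p, q) loses p + q, plus the drop of the remaining moment. -/
theorem step_bound (h : MomentAsymptotics K) {a b p q : ℕ} {e : ℤ} (hp : p ≤ a) (hq : q ≤ b)
    (hK : a - p + (b - q) < K)
    (he : 3 * ((a : ℤ) + b) - (p + q) - degreeDrop (a - p) (b - q) ≤ e) :
    PolyOn 2 e (stepAverage p q (centralMoment (a - p) (b - q))) := by
  refine ((h.bound hK).step p q).mono ?_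
  push_cast [Nat.cast_sub hp, Nat.cast_sub hq]
  linarith

/-- The leading part does not involve the last letter, so it leaves the average; `n - 1` becomes `n`
within the error. -/
theorem step_even_even (h : MomentAsymptotics K) (p q : ℕ) {r s : ℕ} (hK : 2 * r + 2 * s < K) :
    PolyOn 2 (6 * (r : ℤ) + 6 * s - 2 + 2 * ((p : ℤ) + q)) (fun n i =>
      stepAverage p q (centralMoment (2 * r) (2 * s)) n i -
        momentCoeff r s * ((n : ℚ) ^ (3 * r + 3 * s) * stepMoment p q n i)) := by
  have h1 := (h.even_even r s hK).step p q
  have h2 := (PolyOn.replace_leading (momentCoeff r s) (3 * r + 3 * s) (PolyOn.stepMoment p q)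
    (Y := stepMoment p q) (PolyOn.zero.congr fun n i _ _ _ => by ring)).mono
    (e' := 6 * (r : ℤ) + 6 * s - 2 + 2 * ((p : ℤ) + q)) (by push_cast; linarith)
  refine (h1.add h2).congr fun n i hn _ _ => ?_
  rw [stepAverage_sub]
  have := stepAverage_mul_left p q (fun n => momentCoeff r s * (n : ℚ) ^ (3 * r + 3 * s))
    (fun _ _ => 1) n i
  simp only [mul_one] at this
  rw [this, stepAverage_one]
  ring

theorem step_even_even_mean (h : MomentAsymptotics K) (p q : ℕ) {r s : ℕ}
    (hK : 2 * r + 2 * s < K) :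
    PolyOn 2 (6 * (r : ℤ) + 6 * s - 4 + 2 * ((p : ℤ) + q)) (fun n i =>
      stepAverage p q (centralMoment (2 * r) (2 * s)) n i -
        letterMean (centralMoment (2 * r) (2 * s)) (n - 1) * stepMoment p q n i) := by
  refine ((h.even_even_mean r s hK).step p q).congr fun n i hn _ _ => ?_
  rw [stepAverage_sub]
  have := stepAverage_mul_left p q (letterMean (centralMoment (2 * r) (2 * s)))
    (fun _ _ => 1) n i
  simp only [mul_one] at this
  rw [this, stepAverage_one]

theorem step_odd_odd (h : MomentAsymptotics K) (p q : ℕ) {r s : ℕ} (hK : 2 * r + 2 * s + 2 < K) :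
    PolyOn 2 (6 * (r : ℤ) + 6 * s + 2 + 2 * ((p : ℤ) + q)) (fun n i =>
      stepAverage p q (centralMoment (2 * r + 1) (2 * s + 1)) n i -
        (2 * r + 1) * (2 * s + 1) * momentCoeff r s / 8 *
          (((n - 1 : ℕ) : ℚ) ^ (3 * r + 3 * s) * stepAverage p q oddShape n i)) := by
  refine ((h.odd_odd r s hK).step p q).congr fun n i hn _ _ => ?_
  rw [stepAverage_sub, stepAverage_const_mul,
    stepAverage_mul_left p q (fun n => (n : ℚ) ^ (3 * r + 3 * s))]

theorem step_even_odd (h : MomentAsymptotics K) (p q : ℕ) {r s : ℕ} (hK : 2 * r + 2 * s + 1 < K) :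
    PolyOn 2 (6 * (r : ℤ) + 6 * s - 2 + 2 * ((p : ℤ) + q)) (fun n i =>
      stepAverage p q (centralMoment (2 * r) (2 * s + 1)) n i -
        -(6 * r * (2 * s + 1) * momentCoeff r s) *
          (((n - 1 : ℕ) : ℚ) ^ (3 * r + 3 * s - 3) * stepAverage p q cubicShape n i)) := by
  refine ((h.even_odd r s hK).step p q).congr fun n i hn _ _ => ?_
  rw [stepAverage_sub, stepAverage_const_mul,
    stepAverage_mul_left p q (fun n => (n : ℚ) ^ (3 * r + 3 * s - 3))]

end MomentAsymptotics

/-! ### Induction step: even-even and mixed parities -/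

namespace MomentAsymptotics

theorem even_even_term_inv {r s : ℕ} (h : MomentAsymptotics (2 * r + 2 * s)) :
    PolyOn 2 (6 * (r : ℤ) + 6 * s - 4) (fun n i =>
      ((2 * r).choose 2 : ℚ) * stepAverage 2 0 (centralMoment (2 * r - 2) (2 * s)) n i -
        3 * r * momentCoeff r s * (n : ℚ) ^ (3 * r + 3 * s - 1)) := by
  rcases r with _ | r
  · exact PolyOn.zero.congr fun n i _ _ _ => by simp
  have h1 := (h.step_even_even 2 0 (r := r) (s := s) (by omega)).const_mul
    ((2 * (r + 1)).choose 2 : ℚ)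
  have h2 : PolyOn 2 (6 * ((r + 1 : ℕ) : ℤ) + 6 * s - 4) (fun n _ =>
      -6 * (r + 1 : ℕ) * momentCoeff (r + 1) s * (n : ℚ) ^ (3 * r + 3 * s + 1)) :=
    PolyOn.powN _ _ (by push_cast; linarith)
  refine ((h1.mono (by push_cast; linarith)).add h2).congr fun n i hn _ _ => ?_
  rw [show 2 * (r + 1) - 2 = 2 * r by omega, stepMoment_two_zero hn,
    show 3 * (r + 1) + 3 * s - 1 = 3 * r + 3 * s + 2 by omega, Nat.cast_choose_two]
  push_cast
  -- The step variance n²/12 and the factor 36 of the coefficient recursion give the 3 in 3r.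
  linear_combination ((r : ℚ) + 1) * (n : ℚ) ^ (3 * r + 3 * s + 1) * (n - 2) / 12 *
    momentCoeff_succ_left r s

theorem even_even_term_maj {r s : ℕ} (h : MomentAsymptotics (2 * r + 2 * s)) :
    PolyOn 2 (6 * (r : ℤ) + 6 * s - 4) (fun n i =>
      ((2 * s).choose 2 : ℚ) * stepAverage 0 2 (centralMoment (2 * r) (2 * s - 2)) n i -
        3 * s * momentCoeff r s * (n : ℚ) ^ (3 * r + 3 * s - 1)) := by
  rcases s with _ | s
  · exact PolyOn.zero.congr fun n i _ _ _ => by simp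
  have h1 := (h.step_even_even 0 2 (r := r) (s := s) (by omega)).const_mul
    ((2 * (s + 1)).choose 2 : ℚ)
  have h2 : PolyOn 2 (6 * (r : ℤ) + 6 * ((s + 1 : ℕ) : ℤ) - 4) (fun n _ =>
      -6 * (s + 1 : ℕ) * momentCoeff r (s + 1) * (n : ℚ) ^ (3 * r + 3 * s + 1)) :=
    PolyOn.powN _ _ (by push_cast; linarith)
  refine ((h1.mono (by push_cast; linarith)).add h2).congr fun n i hn hi hin => ?_
  rw [show 2 * (s + 1) - 2 = 2 * s by omega, stepMoment_zero_left hi hin, stepMoment_two_zero hn,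
    show 3 * r + 3 * (s + 1) - 1 = 3 * r + 3 * s + 2 by omega, Nat.cast_choose_two]
  push_cast
  linear_combination ((s : ℚ) + 1) * (n : ℚ) ^ (3 * r + 3 * s + 1) * (n - 2) / 12 *
    momentCoeff_succ_right r s

theorem even_even_step {r s : ℕ} (h : MomentAsymptotics (2 * r + 2 * s)) (hrs : 1 ≤ r + s) :
    PolyOn 1 (6 * (r : ℤ) + 6 * s - 2) (fun n i =>
      centralMoment (2 * r) (2 * s) n i - momentCoeff r s * (n : ℚ) ^ (3 * r + 3 * s)) ∧
    PolyOn 1 (6 * (r : ℤ) + 6 * s - 4) (fun n i =>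
      centralMoment (2 * r) (2 * s) n i - letterMean (centralMoment (2 * r) (2 * s)) n) := by
  set M := letterMean (centralMoment (2 * r) (2 * s)) with hM
  -- Apart from the moment itself, only the two variance terms lose less than 4: a remaining moment
  -- with an odd order has a drop of at least 2.
  have h1 := PolyOn.recurrence_sub (e := 6 * (r : ℤ) + 6 * s - 4) (2 * r) (2 * s)
    {(0, 0), (2, 0), (0, 2)} (by
      intro p q hpq hp hq
      simp only [mem_insert, mem_singleton, Prod.mk.injEq] at hpq
      refine h.step_bound hp hq (by omega) ?_
      simp only [degreeDrop]
      push_cast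
      split_ifs <;> omega)
  have h2 : PolyOn 2 (6 * (r : ℤ) + 6 * s - 4) (fun n i =>
      centralMoment (2 * r) (2 * s) n i - M (n - 1) -
        3 * (r + s : ℕ) * momentCoeff r s * (n : ℚ) ^ (3 * r + 3 * s - 1)) := by
    refine ((h1.add h.even_even_term_inv).add h.even_even_term_maj).congr fun n i hn hi hin => ?_
    rw [Finset.sum_insert (by simp), Finset.sum_insert (by simp), Finset.sum_singleton]
    simp only [Nat.choose_zero_right, Nat.sub_zero, stepAverage_zero_zero hn, ← hM]
    push_cast
    ring
  -- The variance terms add up to the derivative of the leading power, hence to its difference.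
  -- Averaging over `i` (`h5`) leaves a difference equation for the mean; `h3` minus `h5` compares
  -- the moment with its mean.
  have h3 : PolyOn 2 (6 * (r : ℤ) + 6 * s - 4) (fun n i =>
      centralMoment (2 * r) (2 * s) n i - M (n - 1) -
        momentCoeff r s * ((n : ℚ) ^ (3 * r + 3 * s) - ((n - 1 : ℕ) : ℚ) ^ (3 * r + 3 * s))) := by
    have h4 := (((PolyOn.pow_difference (3 * r + 3 * s)).2.mono_left (N' := 2)
      (by norm_num)).const_mul (momentCoeff r s)).mono (e' := 6 * (r : ℤ) + 6 * s - 4)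
      (by push_cast; linarith)
    refine (h2.sub h4).congr fun n i hn hi hin => ?_
    push_cast
    ring
  have h5 : PolyOn 2 (6 * (r : ℤ) + 6 * s - 4) (fun n _ =>
      (M n - momentCoeff r s * (n : ℚ) ^ (3 * r + 3 * s)) -
        (M (n - 1) - momentCoeff r s * ((n - 1 : ℕ) : ℚ) ^ (3 * r + 3 * s))) := by
    refine (h3.mean (by norm_num)).congr fun n i hn hi hin => ?_
    rw [letterMean_sub, letterMean_sub, letterMean_const (by omega) (fun n => M (n - 1)),
      letterMean_const (by omega) (fun n => momentCoeff r s * ((n : ℚ) ^ (3 * r + 3 * s) -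
        ((n - 1 : ℕ) : ℚ) ^ (3 * r + 3 * s)))]
    ring
  have h6 := PolyOn.of_difference (h := fun n => M n - momentCoeff r s * (n : ℚ) ^ (3 * r + 3 * s))
    h5 (by omega)
  have hmean : ∀ n : ℕ, 1 ≤ n → letterMean (fun n i => centralMoment (2 * r) (2 * s) n i -
      momentCoeff r s * (n : ℚ) ^ (3 * r + 3 * s)) n =
      M n - momentCoeff r s * (n : ℚ) ^ (3 * r + 3 * s) := fun n hn => by
    rw [letterMean_sub, letterMean_const hn (fun n => momentCoeff r s * (n : ℚ) ^ (3 * r + 3 * s))]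
  have h7 : PolyOn 1 (6 * (r : ℤ) + 6 * s - 2) (fun n i =>
      centralMoment (2 * r) (2 * s) n i - momentCoeff r s * (n : ℚ) ^ (3 * r + 3 * s)) := by
    refine PolyOn.of_two (e' := 6 * (r : ℤ) + 6 * s - 4 + 2)
      (((h3.mono (by linarith)).add (h6.shift.mono (e' := 6 * (r : ℤ) + 6 * s - 2)
        (by linarith))).congr fun n i _ _ _ => ?_) (h6.congr fun n i hn _ _ => hmean n hn)
    ring
  refine ⟨h7, PolyOn.of_two (e' := 0) ((h3.sub h5).congr fun n i _ _ _ => by ring)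
    (PolyOn.zero.congr fun n i hn _ _ => ?_)⟩
  rw [letterMean_sub, letterMean_const hn M, ← hM, sub_self]

theorem step_even_even_eq_zero {K p q : ℕ} (h : MomentAsymptotics K) {r s : ℕ}
    (hK : 2 * r + 2 * s < K)
    (h0 : ∀ n i : ℕ, 2 ≤ n → 1 ≤ i → i ≤ n → stepMoment p q n i = 0) :
    PolyOn 2 (6 * (r : ℤ) + 6 * s - 4 + 2 * ((p : ℤ) + q))
      (stepAverage p q (centralMoment (2 * r) (2 * s))) :=
  (h.step_even_even_mean p q hK).congr fun n i hn hi hin => by rw [h0 n i hn hi hin]; ring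

theorem even_odd_term {r s : ℕ} (h : MomentAsymptotics (2 * r + 2 * s + 1)) :
    PolyOn 2 (6 * (r : ℤ) + 6 * s - 2) (fun n i =>
      ((2 * r).choose 2 : ℚ) * ((2 * s + 1 : ℕ) : ℚ) *
        stepAverage 2 1 (centralMoment (2 * r - 2) (2 * s)) n i -
      -(6 * r * (2 * s + 1) * momentCoeff r s) *
        ((n : ℚ) ^ (3 * r + 3 * s - 3) * cubicShape n i)) := by
  rcases r with _ | r
  · exact PolyOn.zero.congr fun n i _ _ _ => by simp
  have h1 := (h.step_even_even 2 1 (r := r) (s := s) (by omega)).const_mul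
    (((2 * (r + 1)).choose 2 : ℚ) * ((2 * s + 1 : ℕ) : ℚ))
  have h2 := ((PolyOn.powN (N := 2) (36 * momentCoeff (r + 1) s * (r + 1) * (2 * s + 1))
    (3 * r + 3 * s) le_rfl).mul
    (PolyOn.quadratic (1 / 6) (-2 / 3) (1 / 2) (1 / 6) (-1 / 6) 0)).mono
    (e' := 6 * ((r + 1 : ℕ) : ℤ) + 6 * s - 2) (by push_cast; linarith)
  refine ((h1.mono (by push_cast; linarith)).add h2).congr fun n i hn hi hin => ?_
  rw [show 2 * (r + 1) - 2 = 2 * r by omega, stepMoment_two_one hn hi hin, cubicShape,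
    show 3 * (r + 1) + 3 * s - 3 = 3 * r + 3 * s by omega, Nat.cast_choose_two]
  push_cast
  linear_combination ((r : ℚ) + 1) * (2 * s + 1) * (n : ℚ) ^ (3 * r + 3 * s) *
    (-(i * (n - i) * (n - 2 * i)) / 6 +
      ((n : ℚ) ^ 2 / 6 - 2 * n * i / 3 + i ^ 2 / 2 + n / 6 - i / 6)) *
    momentCoeff_succ_left r s

theorem even_odd_step {r s : ℕ} (h : MomentAsymptotics (2 * r + 2 * s + 1)) :
    PolyOn 1 (6 * (r : ℤ) + 6 * s - 2) (fun n i => centralMoment (2 * r) (2 * s + 1) n i -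
      -(6 * r * (2 * s + 1) * momentCoeff r s) *
        ((n : ℚ) ^ (3 * r + 3 * s - 3) * cubicShape n i)) := by
  have h1 := PolyOn.recurrence_sub (e := 6 * (r : ℤ) + 6 * s - 2) (2 * r) (2 * s + 1)
    {(0, 0), (1, 0), (0, 1), (2, 1), (0, 3)} (by
      intro p q hpq hp hq
      simp only [mem_insert, mem_singleton, Prod.mk.injEq] at hpq
      refine h.step_bound hp hq (by omega) ?_
      simp only [degreeDrop]
      push_cast
      split_ifs <;> omega)
  have t1 : PolyOn 2 (6 * (r : ℤ) + 6 * s - 2) (fun n i =>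
      ((2 * r : ℕ) : ℚ) * stepAverage 1 0 (centralMoment (2 * r - 1) (2 * s + 1)) n i) := by
    rcases r with _ | r
    · exact PolyOn.zero.congr fun n i _ _ _ => by simp
    have h2 := h.step_odd_odd 1 0 (r := r) (s := s) (by omega)
    -- Odd step moments vanish, so the average has degree 2 instead of 3, and nothing cancels the
    -- cubic from (2, 1).
    have h3 : PolyOn 2 4 (stepAverage 1 0 oddShape) :=
      (PolyOn.quadratic (-(1 / 3)) 0 0 (2 / 3) 0 0).congr fun n i hn _ _ => by
        rw [stepAverage_oddShape hn, stepMoment_one_zero hn, stepMoment_two_zero hn,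
          stepMoment_three_zero hn]
        ring
    have h4 := (((PolyOn.powN (N := 1) 1 (3 * r + 3 * s) le_rfl).shift.mul h3).const_mul
      ((2 * r + 1) * (2 * s + 1) * momentCoeff r s / 8)).mono
      (e' := 6 * ((r + 1 : ℕ) : ℤ) + 6 * s - 2) (by push_cast; linarith)
    refine (((h2.mono (by push_cast; linarith)).add h4).const_mul
      ((2 * (r + 1) : ℕ) : ℚ)).congr fun n i _ _ _ => ?_
    rw [show 2 * (r + 1) - 1 = 2 * r + 1 by omega]
    ring
  have t2 := ((h.step_even_even_eq_zero (p := 0) (q := 1) (r := r) (s := s) (by omega)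
    fun n i hn hi hin => by rw [stepMoment_zero_left hi hin, stepMoment_one_zero hn]).mono
      (e' := 6 * (r : ℤ) + 6 * s - 2) (by push_cast; linarith)).const_mul ((2 * s + 1 : ℕ) : ℚ)
  have t3 : PolyOn 2 (6 * (r : ℤ) + 6 * s - 2) (fun n i =>
      ((2 * s + 1).choose 3 : ℚ) * stepAverage 0 3 (centralMoment (2 * r) (2 * s + 1 - 3)) n i) := by
    rcases s with _ | s
    · exact PolyOn.zero.congr fun n i _ _ _ => by simp [Nat.choose]
    rw [show 2 * (s + 1) + 1 - 3 = 2 * s by omega]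
    exact ((h.step_even_even_eq_zero (p := 0) (q := 3) (r := r) (s := s) (by omega)
      fun n i hn hi hin => by rw [stepMoment_zero_left hi hin, stepMoment_three_zero hn]).mono
        (by push_cast; linarith)).const_mul _
  have hlead : ∃ e' : ℤ, PolyOn 1 e' (fun n i => -(6 * r * (2 * s + 1) * momentCoeff r s) *
      ((n : ℚ) ^ (3 * r + 3 * s - 3) * cubicShape n i)) :=
    ⟨_, (((PolyOn.powN 1 (3 * r + 3 * s - 3) le_rfl).mul PolyOn.cubicShape).const_mul
      (-(6 * r * (2 * s + 1) * momentCoeff r s))).congr fun n i _ _ _ => by ring⟩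
  obtain ⟨e', hlead⟩ := hlead
  refine PolyOn.of_two (e' := e')
    (((((h1.add t1).add t2).add t3).add h.even_odd_term).congr fun n i hn hi hin => ?_)
    ((hlead.mean le_rfl).neg.congr fun n i hn _ _ => ?_)
  · rw [Finset.sum_insert (by simp), Finset.sum_insert (by simp), Finset.sum_insert (by simp),
      Finset.sum_insert (by simp), Finset.sum_singleton]
    simp only [Nat.choose_zero_right, Nat.choose_one_right, Nat.sub_zero,
      stepAverage_zero_zero hn, Nat.add_sub_cancel]
    rw [letterMean_centralMoment_of_odd (by omega)]
    push_cast
    ring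
  · rw [letterMean_sub, letterMean_centralMoment_of_odd (by omega), zero_sub]

/-- The terms (0, 1) and (1, 2) are each too large but cancel. The terms (1, 0) and (3, 0) are small
because odd moments of `invStep` vanish. -/
theorem odd_even_step {r s : ℕ} (h : MomentAsymptotics (2 * r + 2 * s + 1)) :
    PolyOn 1 (6 * (r : ℤ) + 6 * s - 2) (centralMoment (2 * r + 1) (2 * s)) := by
  have h1 := PolyOn.recurrence_sub (e := 6 * (r : ℤ) + 6 * s - 2) (2 * r + 1) (2 * s)
    {(0, 0), (1, 0), (0, 1), (1, 2), (3, 0)} (by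
      intro p q hpq hp hq
      simp only [mem_insert, mem_singleton, Prod.mk.injEq] at hpq
      refine h.step_bound hp hq (by omega) ?_
      simp only [degreeDrop]
      push_cast
      split_ifs <;> omega)
  have t1 := ((h.step_even_even_eq_zero (p := 1) (q := 0) (r := r) (s := s) (by omega)
    fun n i hn hi hin => stepMoment_one_zero hn i).mono
      (e' := 6 * (r : ℤ) + 6 * s - 2) (by push_cast; linarith)).const_mul ((2 * r + 1 : ℕ) : ℚ)
  have t2 : PolyOn 2 (6 * (r : ℤ) + 6 * s - 2) (fun n i =>
      ((2 * r + 1).choose 3 : ℚ) * stepAverage 3 0 (centralMoment (2 * r + 1 - 3) (2 * s)) n i) := by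
    rcases r with _ | r
    · exact PolyOn.zero.congr fun n i _ _ _ => by simp [Nat.choose]
    rw [show 2 * (r + 1) + 1 - 3 = 2 * r by omega]
    exact ((h.step_even_even_eq_zero (p := 3) (q := 0) (r := r) (s := s) (by omega)
      fun n i hn hi hin => stepMoment_three_zero hn i).mono (by push_cast; linarith)).const_mul _
  have t3 : PolyOn 2 (6 * (r : ℤ) + 6 * s - 2) (fun n i =>
      ((2 * s : ℕ) : ℚ) * stepAverage 0 1 (centralMoment (2 * r + 1) (2 * s - 1)) n i +
      ((2 * r + 1 : ℕ) : ℚ) * ((2 * s).choose 2 : ℚ) *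
        stepAverage 1 2 (centralMoment (2 * r) (2 * s - 2)) n i) := by
    rcases s with _ | s
    · exact PolyOn.zero.congr fun n i _ _ _ => by simp
    have h2 := (h.step_odd_odd 0 1 (r := r) (s := s) (by omega)).const_mul ((2 * (s + 1) : ℕ) : ℚ)
    have h3 := (h.step_even_even 1 2 (r := r) (s := s) (by omega)).const_mul
      (((2 * r + 1 : ℕ) : ℚ) * ((2 * (s + 1)).choose 2 : ℚ))
    -- Only the summand 4 u² of the shape (2u - 1)² matters. Its coefficient 2(s + 1) · 4/8 times 2s
    -- + 1 is the binomial coefficient in the term (1, 2).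
    have h4 := PolyOn.replace_leading ((2 * r + 1) * (2 * s + 1) * momentCoeff r s / 8 *
      ((2 * (s + 1) : ℕ) : ℚ)) (3 * r + 3 * s) (x := 6) (X := stepAverage 0 1 oddShape)
      (Y := fun n i => 4 * stepMoment 2 1 n i)
      (((PolyOn.oddShape (N := 1)).step 0 1).mono (by norm_num))
      ((((PolyOn.stepMoment 0 1).mono (e' := 4) (by norm_num)).sub
        ((PolyOn.stepMoment 1 1).const_mul 4)).congr fun n i hn _ _ => by
          rw [stepAverage_oddShape hn]; ring)
    refine (((h2.mono (by push_cast; linarith)).add (h3.mono (e' := 6 * (r : ℤ) +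
      6 * ((s + 1 : ℕ) : ℤ) - 2) (by push_cast; linarith))).add
      (h4.mono (by push_cast; linarith))).congr fun n i hn hi hin => ?_
    rw [show 2 * (s + 1) - 2 = 2 * s by omega, show 2 * (s + 1) - 1 = 2 * s + 1 by omega,
      stepMoment_one_two hn hi hin, Nat.cast_choose_two]
    push_cast
    ring
  refine PolyOn.of_two (e' := 0)
    ((((h1.add t1).add t2).add t3).congr fun n i hn hi hin => ?_)
    (PolyOn.zero.congr fun n i hn _ _ => letterMean_centralMoment_of_odd (by omega) n)
  rw [Finset.sum_insert (by simp), Finset.sum_insert (by simp), Finset.sum_insert (by simp),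
    Finset.sum_insert (by simp), Finset.sum_singleton]
  simp only [Nat.choose_zero_right, Nat.choose_one_right, Nat.sub_zero,
    stepAverage_zero_zero hn, Nat.add_sub_cancel]
  rw [letterMean_centralMoment_of_odd (by omega)]
  push_cast
  ring

end MomentAsymptotics

/-! ### Induction step: two odd orders -/

theorem letterMean_const_mul (c : ℚ) (f : ℕ → ℕ → ℚ) (n : ℕ) :
    letterMean (fun n i => c * f n i) n = c * letterMean f n :=
  letterMean_mul_left (fun _ => c) f n

theorem stepMoment_zero_zero {n : ℕ} (hn : 2 ≤ n) (i : ℕ) : stepMoment 0 0 n i = 1 := by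
  rw [stepMoment, stepAverage_zero_zero hn, letterMean_const (by omega) (fun _ => 1)]

theorem cast_ne_zero_of_two_le {n : ℕ} (hn : 2 ≤ n) : (n : ℚ) ≠ 0 := by
  have : 0 < n := by omega
  positivity

/-- The product term vanishes with the first moment of `invStep`. Only the diagonal term survives,
one degree smaller than for fixed `i`. -/
theorem letterMean_stepMoment_one_one {n : ℕ} (hn : 2 ≤ n) :
    letterMean (stepMoment 1 1) n = ((n : ℚ) - 2) / 12 := by
  have h := letterMean_stepAverage hn 1 1 1 (fun _ _ => 1)
  simp only [stepAverage_one] at h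
  have h' : letterMean (stepMoment 1 1) n = _ := h
  rw [h', stepMoment_one_zero hn, stepMoment_two_zero hn]
  have := cast_ne_zero_of_two_le hn
  field_simp
  ring

theorem letterMean_stepMoment_three_one {n : ℕ} (hn : 2 ≤ n) :
    letterMean (stepMoment 3 1) n = ((n : ℚ) - 2) * (3 * n ^ 2 - 6 * n - 4) / 240 := by
  have h := letterMean_stepAverage hn 1 3 1 (fun _ _ => 1)
  simp only [stepAverage_one] at h
  have h' : letterMean (stepMoment 3 1) n = _ := h
  rw [h', stepMoment_one_zero hn, stepMoment_four_zero hn]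
  have := cast_ne_zero_of_two_le hn
  field_simp
  ring

theorem letterMean_stepMoment_one_three {n : ℕ} (hn : 2 ≤ n) :
    letterMean (stepMoment 1 3) n = ((n : ℚ) - 2) * (3 * n ^ 2 - 6 * n - 4) / 240 := by
  have h := letterMean_stepAverage hn 1 1 3 (fun _ _ => 1)
  simp only [stepAverage_one] at h
  have h' : letterMean (stepMoment 1 3) n = _ := h
  rw [h', stepMoment_one_zero hn, stepMoment_four_zero hn]
  have := cast_ne_zero_of_two_le hn
  field_simp
  ring

/-- The leading 1/36 is the step variance n²/12 times the mean n²/3 of the shape; the diagonal term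
is only cubic. -/
theorem letterMean_stepAverage_oddShape {n : ℕ} (hn : 2 ≤ n) :
    letterMean (stepAverage 0 2 oddShape) n = (n : ℚ) ^ 4 / 36 +
      ((-5 / 36 + 1 / 20) * n ^ 3 + (11 / 36 - 1 / 5) * n ^ 2 +
        (-13 / 36 + 8 / 60 + 1 / 12) * n + 8 / 60) := by
  rw [letterMean_stepAverage hn 1, stepAverage_oddShape hn, stepAverage_oddShape hn]
  simp only [Nat.zero_add, Nat.reduceAdd]
  rw [stepMoment_one_zero hn, stepMoment_two_zero hn, stepMoment_three_zero hn,
    stepMoment_four_zero hn, stepMoment_zero_zero hn]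
  have := cast_ne_zero_of_two_le hn
  field_simp
  ring

theorem PolyOn.mean_sub {e : ℤ} {T : ℕ → ℕ → ℚ} {X : ℕ → ℚ}
    (h : PolyOn 2 e (fun n i => T n i - X n)) :
    PolyOn 2 e (fun n _ => letterMean T n - X n) :=
  (h.mean (by norm_num)).congr fun n i hn _ _ => by
    rw [letterMean_sub, letterMean_const (by omega) X]

namespace MomentAsymptotics

theorem odd_odd_term_one_zero {r s : ℕ} (h : MomentAsymptotics (2 * r + 2 * s + 2)) :
    PolyOn 2 (6 * (r : ℤ) + 6 * s) (fun n i =>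
      ((2 * r + 1 : ℕ) : ℚ) * stepAverage 1 0 (centralMoment (2 * r) (2 * s + 1)) n i -
        -(1 / 10) * r * (2 * r + 1) * (2 * s + 1) * momentCoeff r s *
          (n : ℚ) ^ (3 * r + 3 * s + 1)) := by
  have h1 := ((h.step_even_odd 1 0 (r := r) (s := s) (by omega)).mono
    (e' := 6 * (r : ℤ) + 6 * s) (by push_cast; linarith)).const_mul ((2 * r + 1 : ℕ) : ℚ)
  rcases r with _ | r
  · exact h1.congr fun n i _ _ _ => by simp
  have h2 := PolyOn.replace_leading (((2 * (r + 1) + 1 : ℕ) : ℚ) *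
    -(6 * ((r + 1 : ℕ) : ℚ) * (2 * s + 1) * momentCoeff (r + 1) s)) (3 * (r + 1) + 3 * s - 3)
    -- 1/60 = -2 · 1/80 + 1/2 · 1/12, from the fourth and second moments of `invStep`.
    (x := 8) (X := stepAverage 1 0 cubicShape) (Y := fun n _ => 1 / 60 * (n : ℚ) ^ 4)
    ((PolyOn.cubicShape.step 1 0).mono (by norm_num))
    ((PolyOn.cubicN (-1 / 15) (1 / 60) (1 / 10) 0).congr fun n i hn _ _ => by
      rw [stepAverage_cubicShape hn, stepMoment_one_zero hn, stepMoment_two_zero hn,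
          stepMoment_three_zero hn, stepMoment_four_zero hn]
      ring)
  refine (h1.add (h2.mono (by omega))).congr fun n i hn _ _ => ?_
  rw [show 3 * (r + 1) + 3 * s + 1 = 3 * (r + 1) + 3 * s - 3 + 4 by omega, pow_add]
  push_cast
  ring

theorem odd_odd_term_two_zero {r s : ℕ} (h : MomentAsymptotics (2 * r + 2 * s + 2)) :
    PolyOn 2 (6 * (r : ℤ) + 6 * s) (fun n i =>
      ((2 * r + 1).choose 2 : ℚ) *
        stepAverage 2 0 (centralMoment (2 * r + 1 - 2) (2 * s + 1)) n i -
        9 / 40 * r * (2 * r + 1) * (2 * s + 1) * momentCoeff r s *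
          (n : ℚ) ^ (3 * r + 3 * s + 1)) := by
  rcases r with _ | r
  · exact PolyOn.zero.congr fun n i _ _ _ => by simp
  have h1 := ((h.step_odd_odd 2 0 (r := r) (s := s) (by omega)).mono
    (e' := 6 * ((r + 1 : ℕ) : ℤ) + 6 * s) (by push_cast; linarith)).const_mul
      ((2 * (r + 1) + 1).choose 2 : ℚ)
  have h2 := PolyOn.replace_leading (((2 * (r + 1) + 1).choose 2 : ℚ) *
    ((2 * r + 1) * (2 * s + 1) * momentCoeff r s / 8)) (3 * r + 3 * s)
    (x := 8) (X := stepAverage 2 0 oddShape) (Y := fun n _ => 1 / 20 * (n : ℚ) ^ 4)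
    ((PolyOn.oddShape.step 2 0).mono (by norm_num))
    ((PolyOn.cubicN (-1 / 5) (8 / 60 + 1 / 12) (8 / 60 - 1 / 6) 0).congr fun n i hn _ _ => by
      rw [stepAverage_oddShape hn, stepMoment_two_zero hn,
          stepMoment_three_zero hn, stepMoment_four_zero hn]
      ring)
  refine (h1.add (h2.mono (by push_cast; linarith))).congr fun n i hn _ _ => ?_
  rw [show 2 * (r + 1) + 1 - 2 = 2 * r + 1 by omega, Nat.cast_choose_two,
    show 3 * (r + 1) + 3 * s + 1 = 3 * r + 3 * s + 4 by omega, pow_add]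
  push_cast
  linear_combination ((r : ℚ) + 1) * (2 * r + 3) * (2 * s + 1) / 160 *
    (n : ℚ) ^ (3 * r + 3 * s) * n ^ 4 * momentCoeff_succ_left r s

theorem odd_odd_term_zero_two {r s : ℕ} (h : MomentAsymptotics (2 * r + 2 * s + 2)) :
    PolyOn 2 (6 * (r : ℤ) + 6 * s) (fun n _ =>
      ((2 * s + 1).choose 2 : ℚ) *
        letterMean (stepAverage 0 2 (centralMoment (2 * r + 1) (2 * s + 1 - 2))) n -
        1 / 8 * s * (2 * r + 1) * (2 * s + 1) * momentCoeff r s *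
          (n : ℚ) ^ (3 * r + 3 * s + 1)) := by
  rcases s with _ | s
  · exact PolyOn.zero.congr fun n i _ _ _ => by simp
  have h1 := (((h.step_odd_odd 0 2 (r := r) (s := s) (by omega)).mean (by norm_num)).mono
    (e' := 6 * (r : ℤ) + 6 * ((s + 1 : ℕ) : ℤ)) (by push_cast; linarith)).const_mul
      ((2 * (s + 1) + 1).choose 2 : ℚ)
  have h2 := PolyOn.replace_leading (((2 * (s + 1) + 1).choose 2 : ℚ) *
    ((2 * r + 1) * (2 * s + 1) * momentCoeff r s / 8)) (3 * r + 3 * s)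
    (x := 8) (X := fun n _ => letterMean (stepAverage 0 2 oddShape) n)
    (Y := fun n _ => 1 / 36 * (n : ℚ) ^ 4)
    (((PolyOn.oddShape.step 0 2).mean (by norm_num)).mono (by norm_num))
    ((PolyOn.cubicN (-5 / 36 + 1 / 20) (11 / 36 - 1 / 5) (-13 / 36 + 8 / 60 + 1 / 12)
      (8 / 60)).congr fun n i hn _ _ => by
      rw [letterMean_stepAverage_oddShape hn]
      ring)
  refine (h1.add (h2.mono (by push_cast; linarith))).congr fun n i hn _ _ => ?_
  rw [show 2 * (s + 1) + 1 - 2 = 2 * s + 1 by omega, Nat.cast_choose_two,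
    show 3 * r + 3 * (s + 1) + 1 = 3 * r + 3 * s + 4 by omega, pow_add, letterMean_sub,
    letterMean_mul_left (fun _ => (2 * (r : ℚ) + 1) * (2 * s + 1) * momentCoeff r s / 8),
    letterMean_mul_left (fun n => ((n - 1 : ℕ) : ℚ) ^ (3 * r + 3 * s))]
  push_cast
  linear_combination ((s : ℚ) + 1) * (2 * s + 3) * (2 * r + 1) / 288 *
    (n : ℚ) ^ (3 * r + 3 * s) * n ^ 4 * momentCoeff_succ_right r s

theorem odd_odd_term_one_one {r s : ℕ} (h : MomentAsymptotics (2 * r + 2 * s + 2)) :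
    PolyOn 2 (6 * (r : ℤ) + 6 * s) (fun n _ =>
      ((2 * r + 1 : ℕ) : ℚ) * ((2 * s + 1 : ℕ) : ℚ) *
        letterMean (stepAverage 1 1 (centralMoment (2 * r) (2 * s))) n -
        1 / 12 * (2 * r + 1) * (2 * s + 1) * momentCoeff r s *
          (n : ℚ) ^ (3 * r + 3 * s + 1)) := by
  have h1 := ((h.step_even_even_mean 1 1 (r := r) (s := s) (by omega)).mean (by norm_num)).mono
    (e' := 6 * (r : ℤ) + 6 * s) (by push_cast; linarith)
  have h2 : PolyOn 1 (6 * (r : ℤ) + 6 * s - 2) (fun n _ =>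
      letterMean (centralMoment (2 * r) (2 * s)) n -
        momentCoeff r s * (n : ℚ) ^ (3 * r + 3 * s)) :=
    ((h.even_even r s (by omega)).mean le_rfl).congr fun n i hn _ _ => by
      rw [letterMean_sub,
        letterMean_const hn (fun n => momentCoeff r s * (n : ℚ) ^ (3 * r + 3 * s))]
  have hl : PolyOn 2 2 (fun n _ => ((n : ℚ) - 2) / 12) :=
    (PolyOn.linear (1 / 12) 0 (-1 / 6)).congr fun n i _ _ _ => by ring
  have h3 := (h2.shift.mul hl).mono (e' := 6 * (r : ℤ) + 6 * s) (by linarith)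
  have h4 := (PolyOn.replace_leading (momentCoeff r s) (3 * r + 3 * s) hl
    (Y := fun n _ => (n : ℚ) / 12)
    ((PolyOn.const (-1 / 6) (by norm_num)).congr fun n i _ _ _ => by ring)).mono
    (e' := 6 * (r : ℤ) + 6 * s) (by push_cast; linarith)
  refine (((h1.add h3).add h4).const_mul
    (((2 * r + 1 : ℕ) : ℚ) * ((2 * s + 1 : ℕ) : ℚ))).congr fun n i hn _ _ => ?_
  rw [letterMean_sub,
    letterMean_mul_left (fun n => letterMean (centralMoment (2 * r) (2 * s)) (n - 1)),
    show letterMean (fun n i => stepMoment 1 1 n i) n = _ from letterMean_stepMoment_one_one hn,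
    pow_succ]
  push_cast
  ring

theorem odd_odd_term_three_one {r s : ℕ} (h : MomentAsymptotics (2 * r + 2 * s + 2)) :
    PolyOn 2 (6 * (r : ℤ) + 6 * s) (fun n _ =>
      ((2 * r + 1).choose 3 : ℚ) *
        letterMean (stepAverage 3 1 (centralMoment (2 * r + 1 - 3) (2 * s))) n) := by
  rcases r with _ | r
  · exact PolyOn.zero.congr fun n i _ _ _ => by simp [Nat.choose]
  have h1 := ((h.step_even_even 3 1 (r := r) (s := s) (by omega)).mean (by norm_num)).mono
    (e' := 6 * ((r + 1 : ℕ) : ℤ) + 6 * s) (by push_cast; linarith)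
  have h2 : PolyOn 2 6 (fun n _ => letterMean (stepMoment 3 1) n) :=
    (PolyOn.cubicN (3 / 240) (-12 / 240) (8 / 240) (8 / 240)).congr fun n i hn _ _ => by
      rw [letterMean_stepMoment_three_one hn]; ring
  have h3 := ((PolyOn.powN (momentCoeff r s) (3 * r + 3 * s) le_rfl).mul h2).mono
    (e' := 6 * ((r + 1 : ℕ) : ℤ) + 6 * s) (by push_cast; linarith)
  refine ((h1.add h3).const_mul ((2 * (r + 1) + 1).choose 3 : ℚ)).congr fun n i hn _ _ => ?_
  rw [letterMean_sub, letterMean_mul_left (fun _ => momentCoeff r s),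
    letterMean_mul_left (fun n => (n : ℚ) ^ (3 * r + 3 * s)),
    show 2 * (r + 1) + 1 - 3 = 2 * r by omega]
  ring

theorem odd_odd_term_one_three {r s : ℕ} (h : MomentAsymptotics (2 * r + 2 * s + 2)) :
    PolyOn 2 (6 * (r : ℤ) + 6 * s) (fun n _ =>
      ((2 * s + 1).choose 3 : ℚ) *
        letterMean (stepAverage 1 3 (centralMoment (2 * r) (2 * s + 1 - 3))) n) := by
  rcases s with _ | s
  · exact PolyOn.zero.congr fun n i _ _ _ => by simp [Nat.choose]
  have h1 := ((h.step_even_even 1 3 (r := r) (s := s) (by omega)).mean (by norm_num)).mono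
    (e' := 6 * (r : ℤ) + 6 * ((s + 1 : ℕ) : ℤ)) (by push_cast; linarith)
  have h2 : PolyOn 2 6 (fun n _ => letterMean (stepMoment 1 3) n) :=
    (PolyOn.cubicN (3 / 240) (-12 / 240) (8 / 240) (8 / 240)).congr fun n i hn _ _ => by
      rw [letterMean_stepMoment_one_three hn]; ring
  have h3 := ((PolyOn.powN (momentCoeff r s) (3 * r + 3 * s) le_rfl).mul h2).mono
    (e' := 6 * (r : ℤ) + 6 * ((s + 1 : ℕ) : ℤ)) (by push_cast; linarith)
  refine ((h1.add h3).const_mul ((2 * (s + 1) + 1).choose 3 : ℚ)).congr fun n i hn _ _ => ?_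
  rw [letterMean_sub, letterMean_mul_left (fun _ => momentCoeff r s),
    letterMean_mul_left (fun n => (n : ℚ) ^ (3 * r + 3 * s)),
    show 2 * (s + 1) + 1 - 3 = 2 * s by omega]
  ring

/-- The difference equation needs one more degree of accuracy than the dependence on `i`, hence more
exceptional terms. Their coefficients -r/10 + 9r/40 + s/8 + 1/12 add up to (3r + 3s + 2)/24, the
derivative of the claimed leading term. -/
theorem odd_odd_mean {r s : ℕ} (h : MomentAsymptotics (2 * r + 2 * s + 2)) :
    PolyOn 1 (6 * (r : ℤ) + 6 * s + 2) (fun n _ =>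
      letterMean (centralMoment (2 * r + 1) (2 * s + 1)) n -
        (2 * r + 1) * (2 * s + 1) * momentCoeff r s / 24 * (n : ℚ) ^ (3 * r + 3 * s + 2)) := by
  set M := letterMean (centralMoment (2 * r + 1) (2 * s + 1)) with hM
  have h1 := (PolyOn.recurrence_sub (e := 6 * (r : ℤ) + 6 * s) (2 * r + 1) (2 * s + 1)
    {(0, 0), (1, 0), (0, 1), (2, 0), (1, 1), (0, 2), (3, 1), (1, 3)} (by
      intro p q hpq hp hq
      simp only [mem_insert, mem_singleton, Prod.mk.injEq] at hpq
      refine h.step_bound hp hq (by omega) ?_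
      simp only [degreeDrop]
      push_cast
      split_ifs <;> omega)).mean (by norm_num)
  have t01 := ((((h.odd_even r s (by omega)).step 0 1).mono (e' := 6 * (r : ℤ) + 6 * s)
    (by push_cast; linarith)).mean (by norm_num)).const_mul ((2 * s + 1 : ℕ) : ℚ)
  have t10 := PolyOn.mean_sub h.odd_odd_term_one_zero
  have t20 := PolyOn.mean_sub h.odd_odd_term_two_zero
  have t31 := h.odd_odd_term_three_one.const_mul ((2 * s + 1 : ℕ) : ℚ)
  have t13 := h.odd_odd_term_one_three.const_mul ((2 * r + 1 : ℕ) : ℚ)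
  have hd := (((PolyOn.pow_difference (3 * r + 3 * s + 2)).2.mono_left (N' := 2)
    (by norm_num)).const_mul ((2 * r + 1) * (2 * s + 1) * momentCoeff r s / 24)).mono
    (e' := 6 * (r : ℤ) + 6 * s) (by push_cast; linarith)
  refine (PolyOn.of_difference (e := 6 * (r : ℤ) + 6 * s) (h := fun n => M n -
    (2 * r + 1) * (2 * s + 1) * momentCoeff r s / 24 * (n : ℚ) ^ (3 * r + 3 * s + 2)) ?_
    (by omega))
  refine ((((((((h1.add t01).add t10).add t20).add h.odd_odd_term_one_one).add
    h.odd_odd_term_zero_two).add t31).add t13).sub hd).congr fun n i hn hi hin => ?_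
  rw [show 3 * r + 3 * s + 2 - 1 = 3 * r + 3 * s + 1 by omega]
  simp only [letterMean_sub, letterMean_const_mul]
  have hsum : letterMean (fun n i => ∑ x ∈ {(0, 0), (1, 0), (0, 1), (2, 0), (1, 1), (0, 2),
      (3, 1), (1, 3)}, ((2 * r + 1).choose x.1 : ℚ) * ((2 * s + 1).choose x.2 : ℚ) *
      stepAverage x.1 x.2 (centralMoment (2 * r + 1 - x.1) (2 * s + 1 - x.2)) n i) n =
    ∑ x ∈ {(0, 0), (1, 0), (0, 1), (2, 0), (1, 1), (0, 2),
      (3, 1), (1, 3)}, ((2 * r + 1).choose x.1 : ℚ) * ((2 * s + 1).choose x.2 : ℚ) *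
      letterMean (stepAverage x.1 x.2 (centralMoment (2 * r + 1 - x.1) (2 * s + 1 - x.2))) n := by
    simp only [letterMean, mul_div_assoc', Finset.mul_sum]
    rw [Finset.sum_comm, Finset.sum_div]
  have h00 : letterMean (stepAverage 0 0 (centralMoment (2 * r + 1) (2 * s + 1))) n =
      M (n - 1) := by
    rw [letterMean_congr (g := fun n _ => M (n - 1))
      (fun i _ _ => stepAverage_zero_zero hn _ i),
      letterMean_const (by omega) (fun n => M (n - 1))]
  rw [hsum, Finset.sum_insert (by simp), Finset.sum_insert (by simp), Finset.sum_insert (by simp),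
    Finset.sum_insert (by simp), Finset.sum_insert (by simp), Finset.sum_insert (by simp),
    Finset.sum_insert (by simp), Finset.sum_singleton]
  simp only [Nat.choose_zero_right, Nat.choose_one_right, Nat.sub_zero, Nat.add_sub_cancel, h00,
    ← hM]
  push_cast
  ring

/-- The mean supplies n²/24 and the term (1, 1) supplies n²/12 - i(n - i)/2; together they are (n -
2i)²/8. -/
theorem odd_odd_step {r s : ℕ} (h : MomentAsymptotics (2 * r + 2 * s + 2)) :
    PolyOn 1 (6 * (r : ℤ) + 6 * s + 2) (fun n i => centralMoment (2 * r + 1) (2 * s + 1) n i -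
      (2 * r + 1) * (2 * s + 1) * momentCoeff r s / 8 *
        ((n : ℚ) ^ (3 * r + 3 * s) * oddShape n i)) := by
  have h1 := PolyOn.recurrence_sub (e := 6 * (r : ℤ) + 6 * s + 2) (2 * r + 1) (2 * s + 1)
    {(0, 0), (1, 1)} (by
      intro p q hpq hp hq
      simp only [mem_insert, mem_singleton, Prod.mk.injEq] at hpq
      refine h.step_bound hp hq (by omega) ?_
      simp only [degreeDrop]
      push_cast
      split_ifs <;> omega)
  have h2 := ((h.step_even_even 1 1 (r := r) (s := s) (by omega)).mono
    (e' := 6 * (r : ℤ) + 6 * s + 2) (by push_cast; linarith)).const_mul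
    (((2 * r + 1 : ℕ) : ℚ) * ((2 * s + 1 : ℕ) : ℚ))
  have h3 := ((PolyOn.powN ((2 * r + 1) * (2 * s + 1) * momentCoeff r s) (3 * r + 3 * s)
    le_rfl).mul (PolyOn.linear (N := 2) (1 / 3) (-1 / 2) 0)).mono
    (e' := 6 * (r : ℤ) + 6 * s + 2) (by push_cast; linarith)
  have h4 := h.odd_odd_mean.shift
  have h5 := ((PolyOn.pow_difference (3 * r + 3 * s + 2)).1.mono_left (N' := 2)
    (by norm_num)).const_mul ((2 * r + 1) * (2 * s + 1) * momentCoeff r s / 24) |>.mono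
    (e' := 6 * (r : ℤ) + 6 * s + 2) (by push_cast; linarith)
  have hlead := ((PolyOn.powN (N := 1) 1 (3 * r + 3 * s) le_rfl).mul PolyOn.oddShape).const_mul
      ((2 * r + 1) * (2 * s + 1) * momentCoeff r s / 8) |>.mono
      (e' := 6 * (r : ℤ) + 6 * s + 4) (by push_cast; linarith)
  have hlead2 := PolyOn.powN (N := 1) (e := 6 * (r : ℤ) + 6 * s + 4)
    ((2 * r + 1) * (2 * s + 1) * momentCoeff r s / 24) (3 * r + 3 * s + 2) (by push_cast; linarith)
  refine PolyOn.of_two (e' := 6 * (r : ℤ) + 6 * s + 4)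
    (((((h1.add h2).add h3).add h4).sub h5).congr fun n i hn hi hin => ?_)
    ((((h.odd_odd_mean.mono (by linarith)).add hlead2).sub (hlead.mean le_rfl)).congr
      fun n i hn _ _ => ?_)
  · rw [Finset.sum_insert (by simp), Finset.sum_singleton]
    simp only [Nat.choose_zero_right, Nat.choose_one_right, Nat.sub_zero,
      stepAverage_zero_zero hn, Nat.add_sub_cancel]
    rw [stepMoment_one_one hn hi hin, oddShape, pow_add]
    push_cast
    ring
  · simp only [letterMean_sub, one_mul]
    ring

end MomentAsymptotics

/-! ### Induction on the total order -/

theorem momentAsymptotics (K : ℕ) : MomentAsymptotics K := by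
  induction K with
  | zero => constructor <;> intros <;> omega
  | succ K ih =>
    have hee : ∀ r s : ℕ, 2 * r + 2 * s = K →
        PolyOn 1 (6 * (r : ℤ) + 6 * s - 2) (fun n i =>
          centralMoment (2 * r) (2 * s) n i - momentCoeff r s * (n : ℚ) ^ (3 * r + 3 * s)) ∧
        PolyOn 1 (6 * (r : ℤ) + 6 * s - 4) (fun n i =>
          centralMoment (2 * r) (2 * s) n i - letterMean (centralMoment (2 * r) (2 * s)) n) := by
      rintro r s rfl
      rcases Nat.eq_zero_or_pos (r + s) with h0 | h0
      · obtain rfl : r = 0 := by omega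
        obtain rfl : s = 0 := by omega
        constructor
        · exact PolyOn.zero.congr fun n i _ hi hin => by
            simp [centralMoment_zero_zero hi hin, momentCoeff_zero]
        · refine PolyOn.zero.congr fun n i hn hi hin => ?_
          rw [letterMean_congr (g := fun _ _ => 1) fun i hi hin => centralMoment_zero_zero hi hin,
            letterMean_const hn (fun _ => 1), centralMoment_zero_zero hi hin, sub_self]
      · exact ih.even_even_step h0
    constructor
    · intro r s h
      rcases Nat.lt_succ_iff_lt_or_eq.1 h with h | h
      exacts [ih.even_even r s h, (hee r s h).1]
    · intro r s h
      rcases Nat.lt_succ_iff_lt_or_eq.1 h with h | h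
      exacts [ih.even_even_mean r s h, (hee r s h).2]
    · intro r s h
      rcases Nat.lt_succ_iff_lt_or_eq.1 h with h | rfl
      exacts [ih.odd_odd r s h, ih.odd_odd_step]
    · intro r s h
      rcases Nat.lt_succ_iff_lt_or_eq.1 h with h | rfl
      exacts [ih.even_odd r s h, ih.even_odd_step]
    · intro r s h
      rcases Nat.lt_succ_iff_lt_or_eq.1 h with h | rfl
      exacts [ih.odd_even r s h, ih.odd_even_step]

/-! ### From central moments to factorial moments -/

/-- The coefficient of `z ^ (r - p)` in the falling factorial of length `r`. -/
def fallingCoeff : ℕ → ℕ → ℚ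
  | 0, 0 => 1
  | 0, _ + 1 => 0
  | r + 1, 0 => fallingCoeff r 0
  | r + 1, p + 1 => fallingCoeff r (p + 1) - r * fallingCoeff r p

theorem fallingCoeff_zero_right (r : ℕ) : fallingCoeff r 0 = 1 := by
  induction r with
  | zero => rfl
  | succ r ih => rw [fallingCoeff, ih]

theorem fallingCoeff_one_right (r : ℕ) : fallingCoeff r 1 = -(r * (r - 1) / 2) := by
  induction r with
  | zero => simp [fallingCoeff]
  | succ r ih =>
    rw [fallingCoeff, ih, fallingCoeff_zero_right]
    push_cast
    ring

theorem fallingCoeff_eq_zero {r p : ℕ} (h : r < p) : fallingCoeff r p = 0 := by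
  induction r generalizing p with
  | zero =>
    obtain ⟨p, rfl⟩ : ∃ k, p = k + 1 := ⟨p - 1, by omega⟩
    rfl
  | succ r ih =>
    obtain ⟨p, rfl⟩ : ∃ k, p = k + 1 := ⟨p - 1, by omega⟩
    rw [fallingCoeff, ih (by omega), ih (by omega)]
    ring

theorem fallingFactorial_eq_sum (z : ℚ) (r : ℕ) :
    fallingFactorial z r = ∑ p ∈ range (r + 1), fallingCoeff r p * z ^ (r - p) := by
  induction r with
  | zero => simp [fallingFactorial, fallingCoeff]
  | succ r ih =>
    have h : fallingFactorial z (r + 1) = fallingFactorial z r * (z - r) := by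
      simp only [fallingFactorial, Finset.prod_range_succ]
    have h1 : ∑ p ∈ range (r + 1), fallingCoeff r p * z ^ (r - p) * z =
        ∑ p ∈ range (r + 1 + 1), fallingCoeff r p * z ^ (r + 1 - p) := by
      rw [Finset.sum_range_succ _ (r + 1), fallingCoeff_eq_zero (Nat.lt_succ_self r), zero_mul,
        add_zero]
      refine sum_congr rfl fun p hp => ?_
      rw [mem_range] at hp
      rw [show r + 1 - p = r - p + 1 by omega, pow_succ]
      ring
    rw [h, ih, mul_sub, Finset.sum_mul, h1, Finset.sum_range_succ', Finset.sum_range_succ' _ (r + 1),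
      Finset.sum_mul, add_sub_right_comm, ← Finset.sum_sub_distrib]
    congr 1
    refine sum_congr rfl fun p _ => ?_
    rw [fallingCoeff, show r + 1 - (p + 1) = r - p by omega]
    ring

theorem centralMoment_one_zero {n i : ℕ} (hi : 1 ≤ i) (hin : i ≤ n) :
    centralMoment 1 0 n i = 0 :=
  -- The doubled degree is at most -2, so the polynomial is zero. This identifies `invMajMean` as
  -- the mean.
  (((momentAsymptotics 2).odd_even 0 0 (by norm_num)).zero_of_neg (by norm_num)) n i
    (by omega) hi hin

theorem centralMoment_zero_one {n i : ℕ} (hi : 1 ≤ i) (hin : i ≤ n) :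
    centralMoment 0 1 n i = 0 := by
  have := (((momentAsymptotics 2).even_odd 0 0 (by norm_num)).zero_of_neg (by norm_num)) n i
    (by omega) hi hin
  simpa using this

theorem average_permInv {n i : ℕ} (hi : 1 ≤ i) (hin : i ≤ n) :
    average (permsEndingIn n i) (fun π => (permInv π : ℚ)) = invMajMean n i := by
  have h := centralMoment_one_zero hi hin
  have hf : ((n - 1).factorial : ℚ) ≠ 0 := by positivity
  simp only [centralMoment, pow_one, pow_zero, mul_one, Finset.sum_sub_distrib, sum_const,
    card_permsEndingIn hi hin, nsmul_eq_mul, div_eq_zero_iff, hf, or_false] at h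
  rw [average, card_permsEndingIn hi hin, div_eq_iff hf]
  linarith

theorem average_permMaj {n i : ℕ} (hi : 1 ≤ i) (hin : i ≤ n) :
    average (permsEndingIn n i) (fun π => (permMaj π : ℚ)) = invMajMean n i := by
  have h := centralMoment_zero_one hi hin
  have hf : ((n - 1).factorial : ℚ) ≠ 0 := by positivity
  simp only [centralMoment, pow_one, pow_zero, one_mul, Finset.sum_sub_distrib, sum_const,
    card_permsEndingIn hi hin, nsmul_eq_mul, div_eq_zero_iff, hf, or_false] at h
  rw [average, card_permsEndingIn hi hin, div_eq_iff hf]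
  linarith

theorem FM_eq_sum (r s : ℕ) {n i : ℕ} (hi : 1 ≤ i) (hin : i ≤ n) :
    FM r s n i = ∑ p ∈ range (r + 1), ∑ q ∈ range (s + 1),
      fallingCoeff r p * fallingCoeff s q * centralMoment (r - p) (s - q) n i := by
  rw [FM, mixedFactorialMoment, average_permInv hi hin, average_permMaj hi hin, average,
    card_permsEndingIn hi hin]
  simp only [centralMoment, mul_div_assoc', ← Finset.sum_div, Finset.mul_sum]
  congr 1
  rw [sum_congr rfl fun p _ => sum_comm, sum_comm]
  refine sum_congr rfl fun π _ => ?_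
  rw [fallingFactorial_eq_sum, fallingFactorial_eq_sum, Finset.sum_mul_sum]
  refine sum_congr rfl fun p _ => sum_congr rfl fun q _ => ?_
  ring

/-- Here no steps restore the degree: each lost power costs a full 3 in doubled degree. -/
theorem PolyOn.FM_sub {e : ℤ} (a b : ℕ) (S : Finset (ℕ × ℕ))
    (h : ∀ p q : ℕ, (p, q) ∉ S → p ≤ a → q ≤ b →
      3 * ((a : ℤ) + b) - 3 * (p + q) - degreeDrop (a - p) (b - q) ≤ e) :
    PolyOn 1 e (fun n i => FM a b n i - ∑ x ∈ S, fallingCoeff a x.1 * fallingCoeff b x.2 *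
      centralMoment (a - x.1) (b - x.2) n i) := by
  refine (PolyOn.double_sum_sub (a := a) (b := b) S (fun x n i =>
    fallingCoeff a x.1 * fallingCoeff b x.2 * centralMoment (a - x.1) (b - x.2) n i) ?_ ?_).congr
    fun n i hn hi hin => by rw [FM_eq_sum a b hi hin]
  · rintro x (hx | hx) <;> funext n i <;> simp [fallingCoeff_eq_zero hx]
  · intro p q hpq hp hq
    refine (((momentAsymptotics (a + b + 1)).bound (a := a - p) (b := b - q) (by omega)).mono
      ?_).const_mul _
    have := h p q hpq hp hq
    push_cast [Nat.cast_sub hp, Nat.cast_sub hq]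
    linarith

theorem PolyOn.eqUpToLowerTotalDegree {f : ℕ → ℕ → ℚ} {L : MvPolynomial (Fin 2) ℚ} {d : ℕ} {e : ℤ}
    (h : PolyOn 1 e (fun n i => f n i - MvPolynomial.eval ![(n : ℚ), (i : ℚ)] L))
    (he : e < 2 * d) : EqUpToLowerTotalDegree f L d := by
  obtain ⟨g, hg, hg'⟩ := h
  obtain ⟨Q, hQ, hQ'⟩ := polyFun_exists_mvPolynomial hg
  refine ⟨Q, fun m hm => ?_, fun n i hi hin => ?_⟩
  · have := hQ m hm
    omega
  · rw [map_add, ← hQ', ← hg' n i (by omega) hi hin]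
    ring

theorem momentConst_succ_left (r s : ℕ) :
    momentConst (r + 1) s = (2 * r + 1) * momentConst r s := by
  simp only [momentConst, double_factorial_step]; ring

theorem momentConst_succ_right (r s : ℕ) :
    momentConst r (s + 1) = (2 * s + 1) * momentConst r s := by
  simp only [momentConst, double_factorial_step]; ring

theorem FM_even_even (r s : ℕ) : PolyOn 1 (6 * (r : ℤ) + 6 * s - 2) (fun n i =>
    FM (2 * r) (2 * s) n i - momentCoeff r s * (n : ℚ) ^ (3 * r + 3 * s)) := by
  have h := PolyOn.FM_sub (e := 6 * (r : ℤ) + 6 * s - 2) (2 * r) (2 * s) {(0, 0)} (by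
    intro p q hpq hp hq
    simp only [mem_singleton, Prod.mk.injEq] at hpq
    simp only [degreeDrop]
    push_cast
    split_ifs <;> omega)
  refine (h.add ((momentAsymptotics _).even_even r s (Nat.lt_succ_self _))).congr
    fun n i _ _ _ => ?_
  rw [Finset.sum_singleton]
  simp only [fallingCoeff_zero_right, Nat.sub_zero]
  ring

/-- A moment with one odd order has drop 3, so the even-even moment one order lower has the same
size. It enters with the second coefficient -s(2s + 1) of the falling factorial. -/
theorem FM_even_odd (r s : ℕ) : PolyOn 1 (6 * (r : ℤ) + 6 * s - 2) (fun n i =>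
    FM (2 * r) (2 * s + 1) n i - (2 * s + 1) * momentCoeff r s *
      (-(s * (n : ℚ) ^ (3 * r + 3 * s)) -
        6 * r * ((n : ℚ) ^ (3 * r + 3 * s - 3) * cubicShape n i))) := by
  have h := PolyOn.FM_sub (e := 6 * (r : ℤ) + 6 * s - 2) (2 * r) (2 * s + 1) {(0, 0), (0, 1)} (by
    intro p q hpq hp hq
    simp only [mem_insert, mem_singleton, Prod.mk.injEq] at hpq
    simp only [degreeDrop]
    push_cast
    split_ifs <;> omega)
  refine ((h.add ((momentAsymptotics _).even_odd r s (Nat.lt_succ_self _))).add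
    (((momentAsymptotics _).even_even r s (Nat.lt_succ_self _)).const_mul (-(s * (2 * s + 1))))).congr
    fun n i _ _ _ => ?_
  rw [Finset.sum_insert (by simp), Finset.sum_singleton]
  simp only [fallingCoeff_zero_right, fallingCoeff_one_right, Nat.sub_zero, Nat.add_sub_cancel]
  push_cast
  ring

theorem FM_odd_even (r s : ℕ) : PolyOn 1 (6 * (r : ℤ) + 6 * s - 2) (fun n i =>
    FM (2 * r + 1) (2 * s) n i -
      -((2 * r + 1) * momentCoeff r s * r * (n : ℚ) ^ (3 * r + 3 * s))) := by
  have h := PolyOn.FM_sub (e := 6 * (r : ℤ) + 6 * s - 2) (2 * r + 1) (2 * s) {(0, 0), (1, 0)} (by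
    intro p q hpq hp hq
    simp only [mem_insert, mem_singleton, Prod.mk.injEq] at hpq
    simp only [degreeDrop]
    push_cast
    split_ifs <;> omega)
  refine ((h.add ((momentAsymptotics _).odd_even r s (Nat.lt_succ_self _))).add
    (((momentAsymptotics _).even_even r s (Nat.lt_succ_self _)).const_mul (-(r * (2 * r + 1))))).congr
    fun n i _ _ _ => ?_
  rw [Finset.sum_insert (by simp), Finset.sum_singleton]
  simp only [fallingCoeff_zero_right, fallingCoeff_one_right, Nat.sub_zero, Nat.add_sub_cancel]
  push_cast
  ring

theorem FM_odd_odd (r s : ℕ) : PolyOn 1 (6 * (r : ℤ) + 6 * s + 2) (fun n i =>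
    FM (2 * r + 1) (2 * s + 1) n i - (2 * r + 1) * (2 * s + 1) * momentCoeff r s / 8 *
        ((n : ℚ) ^ (3 * r + 3 * s) * oddShape n i)) := by
  have h := PolyOn.FM_sub (e := 6 * (r : ℤ) + 6 * s + 2) (2 * r + 1) (2 * s + 1) {(0, 0)} (by
    intro p q hpq hp hq
    simp only [mem_singleton, Prod.mk.injEq] at hpq
    simp only [degreeDrop]
    push_cast
    split_ifs <;> omega)
  refine (h.add ((momentAsymptotics _).odd_odd r s (Nat.lt_succ_self _))).congr
    fun n i _ _ _ => ?_
  rw [Finset.sum_singleton]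
  simp only [fallingCoeff_zero_right, Nat.sub_zero]
  ring

/-! ### The main theorem -/

open MvPolynomial in
theorem mainTheorem2 :
    -- polynomiality in `(n, i)` of every mixed factorial moment
    (∀ r s : ℕ, ∃ P : MvPolynomial (Fin 2) ℚ, RepresentedBy (FM r s) P) ∧
    -- even, even
    (∀ r s : ℕ,
      EqUpToLowerTotalDegree (FM (2 * r) (2 * s))
        (C (momentConst r s * (1 / 36) ^ (r + s)) * X 0 ^ (3 * r + 3 * s))
        (3 * r + 3 * s)) ∧
    -- even, odd; for `r = 0`, `s = 1` the bracket is zero, and so is the leading part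
    (∀ r s : ℕ, 1 ≤ s →
      EqUpToLowerTotalDegree (FM (2 * r) (2 * s - 1))
        (C (momentConst r s * (1 / 36) ^ (r + s - 1)) * X 0 ^ (3 * r + 3 * s - 6) *
          (-(C ((s : ℚ) - 1) * X 0 ^ 3) - C (6 * (r : ℚ)) * X 0 ^ 2 * X 1
            + C (18 * (r : ℚ)) * X 0 * X 1 ^ 2 - C (12 * (r : ℚ)) * X 1 ^ 3))
        (3 * r + 3 * s - 3)) ∧
    -- odd, even
    (∀ r s : ℕ, 1 ≤ r →
      EqUpToLowerTotalDegree (FM (2 * r - 1) (2 * s))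
        (-(C (momentConst r s * (1 / 36) ^ (r + s - 1) * ((r : ℚ) - 1)) *
          X 0 ^ (3 * r + 3 * s - 3)))
        (3 * r + 3 * s - 3)) ∧
    -- odd, odd
    (∀ r s : ℕ, 1 ≤ r → 1 ≤ s →
      EqUpToLowerTotalDegree (FM (2 * r - 1) (2 * s - 1))
        (C (momentConst r s * (1 / 36) ^ (r + s - 1) * (9 / 2)) * X 0 ^ (3 * r + 3 * s - 6) *
          (X 0 - 2 * X 1) ^ 2)
        (3 * r + 3 * s - 4)) := by
  refine ⟨fun r s => ?_, fun r s => ?_, fun r s hs => ?_, fun r s hr => ?_, fun r s hr hs => ?_⟩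
  · obtain ⟨g, hg, hg'⟩ := PolyOn.FM_sub (e := 3 * ((r : ℤ) + s)) r s ∅ (by
      intro p q _ _ _
      simp only [degreeDrop]
      split_ifs <;> omega)
    obtain ⟨Q, -, hQ⟩ := polyFun_exists_mvPolynomial hg
    refine ⟨Q, fun n i hi hin => ?_⟩
    rw [← hQ, ← hg' n i (by omega) hi hin]
    simp
  · refine ((FM_even_even r s).congr fun n i _ _ _ => ?_).eqUpToLowerTotalDegree
      (by push_cast; omega)
    simp [momentCoeff]
  · obtain ⟨s, rfl⟩ : ∃ k, s = k + 1 := ⟨s - 1, by omega⟩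
    refine ((FM_even_odd r s).congr fun n i _ _ _ => ?_).eqUpToLowerTotalDegree
      (by omega)
    rw [show 2 * (s + 1) - 1 = 2 * s + 1 by omega, show r + (s + 1) - 1 = r + s by omega,
      show 3 * r + 3 * (s + 1) - 6 = 3 * r + 3 * s - 3 by omega, momentConst_succ_right]
    simp only [map_mul, map_add, map_sub, map_neg, map_pow, eval_C, eval_X, Matrix.cons_val_zero,
      Matrix.cons_val_one, momentCoeff, cubicShape]
    -- When `r + s = 0` the exponent 3r + 3s - 3 truncates to 0 and cannot be split off, but both
    -- sides vanish.
    rcases Nat.eq_zero_or_pos (r + s) with h | h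
    · obtain rfl : r = 0 := by omega
      obtain rfl : s = 0 := by omega
      simp
    · rw [show 3 * r + 3 * s = 3 * r + 3 * s - 3 + 3 by omega, pow_add, Nat.add_sub_cancel]
      push_cast
      ring
  · obtain ⟨r, rfl⟩ : ∃ k, r = k + 1 := ⟨r - 1, by omega⟩
    refine ((FM_odd_even r s).congr fun n i _ _ _ => ?_).eqUpToLowerTotalDegree
      (by omega)
    rw [show 2 * (r + 1) - 1 = 2 * r + 1 by omega, show r + 1 + s - 1 = r + s by omega,
      show 3 * (r + 1) + 3 * s - 3 = 3 * r + 3 * s by omega, momentConst_succ_left]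
    simp only [map_mul, map_neg, map_pow, eval_C, eval_X, Matrix.cons_val_zero, momentCoeff]
    push_cast
    ring
  · obtain ⟨r, rfl⟩ : ∃ k, r = k + 1 := ⟨r - 1, by omega⟩
    obtain ⟨s, rfl⟩ : ∃ k, s = k + 1 := ⟨s - 1, by omega⟩
    refine ((FM_odd_odd r s).congr fun n i _ _ _ => ?_).eqUpToLowerTotalDegree
      (by omega)
    rw [show 2 * (r + 1) - 1 = 2 * r + 1 by omega, show 2 * (s + 1) - 1 = 2 * s + 1 by omega,
      show r + 1 + (s + 1) - 1 = r + s + 1 by omega,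
      show 3 * (r + 1) + 3 * (s + 1) - 6 = 3 * r + 3 * s by omega, momentConst_succ_left,
      momentConst_succ_right]
    simp only [map_mul, map_sub, map_pow, map_ofNat, eval_C, eval_X, Matrix.cons_val_zero,
      Matrix.cons_val_one, momentCoeff, oddShape]
    -- The constant 9/2 is 36/8, the extra 36 coming from the exponent r + s + 1.
    ring
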